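/- **Theorem 6.1 (simplicity).** Let $k\ge 1$, let $\Lambda$ be a row-finite $k$-graph without sources with at least one vertex, and let $R$ be a commutative ring with $1$. Then the Kumjian–Pask algebra $\mathrm{KP}_R(\Lambda)$ is simple if and only if $R$ is a field and $\Lambda$ is aperiodic and cofinal. Here the terms have the following meaning. * A *$k$-graph* is a countable category $\Lambda$ with object set $\Lambda^0$ (the vertices), whose morphisms $\lambda$ (the paths) have domain $s(\lambda)$ and codomain $r(\lambda)$, together with a functor $d:\Lambda\to\mathbb N^k$ such that whenever $d(\lambda)=m+n$ with $m,n\in\mathbb N^k$ there are unique paths $\mu,\nu$ with $d(\mu)=m$, $d(\nu)=n$ and $\lambda=\mu\nu$. Write $\Lambda^{\ne 0}=\{\lambda: d(\lambda)\neq 0\}$, and for $v\in\Lambda^0$, $n\in\mathbb N^k$ write $v\Lambda^n=\{\lambda: r(\lambda)=v,\ d(\lambda)=n\}$. $\Lambda$ is *row-finite* (respectively *has no sources*) if every $v\Lambda^n$ is finite (respectively nonempty). * For $p\le q\le d(\lambda)$ in the coordinatewise order, $\lambda(p,q)$ is the unique path $\lambda''$ such that $\lambda=\lambda'\lambda''\lambda'''$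 with $d(\lambda')=p$, $d(\lambda'')=q-p$ and $d(\lambda''')=d(\lambda)-q$. $\Lambda$ is *aperiodic* if for every $v\in\Lambda^0$ and all $m\ne n$ in $\mathbb N^k$ there is a path $\lambda$ with $r(\lambda)=v$ and $d(\lambda)\ge m\vee n$ (the coordinatewise maximum) such that $$\lambda\big(m,\,m+d(\lambda)-(m\vee n)\big)\neq\lambda\big(n,\,n+d(\lambda)-(m\vee n)\big).$$ * Let $\Omega_k$ be the category with object set $\mathbb N^k$ and exactly one morphism $(p,q)$, with codomain $p$, domain $q$ and degree $q-p$, for each $p\le q$ (and no others). An *infinite path* is a degree-preserving functor $x:\Omega_k\to\Lambda$; $x(n)$ denotes its vertex at $n\in\mathbb N^k$. $\Lambda$ is *cofinal* if for every infinite path $x$ and every $v\in\Lambda^0$ there are $n\in\mathbb N^k$ and a path with range $v$ and source $x(n)$. * $\mathrm{KP}_R(\Lambda)$ is the associative, not necessarily unital, $R$-algebra generated by elements $p_v$ $(v\in\Lambda^0)$ and $s_\lambda, s_{\lambda^*}$ $(\lambda\in\Lambda^{\neq0})$ subject to the relations 1. $p_vp_w=\delta_{v,w}p_v$ for $v,w\in\Lambda^0$;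 2. $s_\lambda s_\mu=s_{\lambda\mu}$ and $s_{\mu^*}s_{\lambda^*}=s_{(\lambda\mu)^*}$ for $\lambda,\mu\in\Lambda^{\ne0}$ with $s(\lambda)=r(\mu)$, and $p_{r(\lambda)}s_\lambda=s_\lambda=s_\lambda p_{s(\lambda)}$, $p_{s(\lambda)}s_{\lambda^*}=s_{\lambda^*}=s_{\lambda^*}p_{r(\lambda)}$ for $\lambda\in\Lambda^{\ne0}$; 3. $s_{\lambda^*}s_\mu=\delta_{\lambda,\mu}p_{s(\lambda)}$ for $\lambda,\mu\in\Lambda^{\neq 0}$ with $d(\lambda)=d(\mu)$; 4. $p_v=\sum_{\lambda\in v\Lambda^n}s_\lambda s_{\lambda^*}$ for $v\in\Lambda^0$ and $n\in\mathbb N^k\setminus\{0\}$. That is, it is the quotient, by the ideal these relations generate, of the free non-unital $R$-algebra on these generators. * A ring $A$ (possibly without unit) is *simple* if $A\neq 0$ and its only two-sided ideals are $\{0\}$ and $A$. -/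

import Mathlib

universe u v w

open CategoryTheory

/-- A morphism of the category `Λ`, together with its domain `src` and its codomain `tgt`:
`CatPath Λ` is the set of all morphisms of `Λ`. -/
@[ext]
structure CatPath (Λ : Type u) [Category.{v} Λ] where
  /-- the source `s(l)`, i.e. the domain -/
  src : Λ
  /-- the range `r(l)`, i.e. the codomain -/
  tgt : Λ
  /-- the morphism itself -/
  hom : src ⟶ tgt

/-- The structure of a `k`-graph on the category `Λ`: the category is countable, and there is a
functor `deg` to the one-object category `ℕᵏ` with the factorization property.  The
juxtaposition `μν` (for `s(μ) = r(ν)`) is the composite of `ν` followed by `μ`, i.e. `ν ≫ μ`. -/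
structure KGraph (k : ℕ) (Λ : Type u) [Category.{v} Λ] where
  /-- the degree functor on morphisms -/
  deg : ∀ {a b : Λ}, (a ⟶ b) → (Fin k → ℕ)
  deg_id : ∀ a : Λ, deg (𝟙 a) = 0
  deg_comp : ∀ {a b c : Λ} (f : a ⟶ b) (g : b ⟶ c), deg (f ≫ g) = deg f + deg g
  /-- a path of degree `m + n` is uniquely `μν` with `d(μ) = m` and `d(ν) = n` -/
  factorization : ∀ {a c : Λ} (f : a ⟶ c) (m n : Fin k → ℕ), deg f = m + n →
    ∃! t : (Σ b : Λ, (b ⟶ c) × (a ⟶ b)),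
      deg t.2.1 = m ∧ deg t.2.2 = n ∧ t.2.2 ≫ t.2.1 = f
  countable : Countable (CatPath Λ)

namespace KGraph

variable {k : ℕ} {Λ : Type u} [Category.{v} Λ]

/-- The set `vΛⁿ` of paths of degree `n` with range `v`. -/
def pathsTo (G : KGraph k Λ) (v : Λ) (n : Fin k → ℕ) : Set (CatPath Λ) :=
  {l | l.tgt = v ∧ G.deg l.hom = n}

/-- `vΛⁿ` is finite for all `v` and `n`. -/
def RowFinite (G : KGraph k Λ) : Prop := ∀ v n, (G.pathsTo v n).Finite

/-- `vΛⁿ` is nonempty for all `v` and `n`. -/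
def NoSources (G : KGraph k Λ) : Prop := ∀ v n, (G.pathsTo v n).Nonempty

/-- For `p ≤ q ≤ d(l)` there is exactly one `e` of degree `q - p` for which `l = l' e l''` with
`d(l') = p` (and hence `d(l'') = d(l) - q`). -/
theorem existsUnique_segment (G : KGraph k Λ) (l : CatPath Λ) (p q : Fin k → ℕ) (hpq : p ≤ q)
    (hq : q ≤ G.deg l.hom) :
    ∃! e : CatPath Λ, G.deg e.hom = q - p ∧
      ∃ (a : e.tgt ⟶ l.tgt) (c : l.src ⟶ e.src), G.deg a = p ∧ c ≫ e.hom ≫ a = l.hom := by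
  obtain ⟨⟨b, a, f⟩, ⟨ha, hf, haf⟩, hu⟩ := G.factorization l.hom p (G.deg l.hom - p)
    (add_tsub_cancel_of_le (hpq.trans hq)).symm
  obtain ⟨⟨b', e, c⟩, ⟨he, hc, hec⟩, hu'⟩ := G.factorization f (q - p) (G.deg l.hom - q)
    (by dsimp only at hf; rw [hf, add_comm, tsub_add_tsub_cancel hq hpq])
  dsimp only at *
  refine ⟨⟨b', b, e⟩, ⟨he, a, c, ha, by rw [← Category.assoc, hec, haf]⟩, ?_⟩
  rintro ⟨s, t, e₁⟩ ⟨he₁, a₁, c₁, ha₁, h₁⟩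
  dsimp only at *
  have hdeg := congrArg G.deg h₁
  rw [G.deg_comp, G.deg_comp, he₁, ha₁, tsub_add_cancel_of_le hpq] at hdeg
  have hc₁ : G.deg c₁ = G.deg l.hom - q := by rw [← hdeg, add_tsub_cancel_right]
  have h2 := hu ⟨t, a₁, c₁ ≫ e₁⟩ ⟨ha₁, by
    rw [G.deg_comp, hc₁, he₁, tsub_add_tsub_cancel hq hpq], by rw [Category.assoc, h₁]⟩
  obtain ⟨rfl, h2⟩ := Sigma.mk.inj h2
  obtain ⟨rfl, h3⟩ := Prod.mk.inj (eq_of_heq h2)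
  have h4 := hu' ⟨s, e₁, c₁⟩ ⟨he₁, hc₁, h3⟩
  obtain ⟨rfl, h4⟩ := Sigma.mk.inj h4
  obtain ⟨rfl, -⟩ := Prod.mk.inj (eq_of_heq h4)
  rfl

/-- The segment `l(p, q)` of the path `l`, for `p ≤ q ≤ d(l)`. -/
noncomputable def segment (G : KGraph k Λ) (l : CatPath Λ) (p q : Fin k → ℕ) (hpq : p ≤ q)
    (hq : q ≤ G.deg l.hom) : CatPath Λ :=
  (G.existsUnique_segment l p q hpq hq).choose

theorem segment_bound {d m n : Fin k → ℕ} (h : m ⊔ n ≤ d) (i : Fin k → ℕ) (hi : i ≤ m ⊔ n) :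
    i + (d - (m ⊔ n)) ≤ d :=
  (add_le_add hi le_rfl).trans (add_tsub_cancel_of_le h).le

/-- Aperiodicity (finite-path formulation): for every vertex `v` and all `m ≠ n` there is a path
`l` with range `v` and `d(l) ≥ m ∨ n` such that
`l(m, m + d(l) - (m ∨ n)) ≠ l(n, n + d(l) - (m ∨ n))`. -/
def Aperiodic (G : KGraph k Λ) : Prop :=
  ∀ (v : Λ) (m n : Fin k → ℕ), m ≠ n →
    ∃ (l : CatPath Λ) (_ : l.tgt = v) (h : m ⊔ n ≤ G.deg l.hom),
      G.segment l m (m + (G.deg l.hom - (m ⊔ n))) le_self_add (segment_bound h m le_sup_left) ≠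
      G.segment l n (n + (G.deg l.hom - (m ⊔ n))) le_self_add (segment_bound h n le_sup_right)

/-- The objects of the category `Ω_k`, i.e. the elements of `ℕᵏ`. -/
@[ext]
structure Omega (k : ℕ) where
  /-- the corresponding element of `ℕᵏ` -/
  pt : Fin k → ℕ

/-- `Ω_k` has one morphism `(p, q)`, with range `p` and source `q`, for each `p ≤ q`, and no other
morphisms. -/
instance (k : ℕ) : Category.{0} (Omega k) where
  Hom q p := PLift (p.pt ≤ q.pt)
  id _ := ⟨le_rfl⟩
  comp f g := ⟨g.down.trans f.down⟩

/-- An infinite path: a degree-preserving functor from `Ω_k` to `Λ`, where `(p, q)` has degree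
`q - p`. -/
structure InfinitePath (G : KGraph k Λ) where
  /-- the functor -/
  toFunctor : Omega k ⥤ Λ
  deg_map : ∀ {q p : Omega k} (f : q ⟶ p), G.deg (toFunctor.map f) = q.pt - p.pt

/-- The vertex `x(n)` of an infinite path. -/
def InfinitePath.vertex {G : KGraph k Λ} (x : G.InfinitePath) (n : Fin k → ℕ) : Λ :=
  x.toFunctor.obj ⟨n⟩

/-- Cofinality: for every infinite path `x` and every vertex `v` there is `n` for which some path
has range `v` and source `x(n)`. -/
def Cofinal (G : KGraph k Λ) : Prop :=
  ∀ (x : G.InfinitePath) (v : Λ), ∃ n : Fin k → ℕ, Nonempty (x.vertex n ⟶ v)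

/-- The paths of nonzero degree. -/
abbrev NonzeroPath (G : KGraph k Λ) : Type (max u v) := {l : CatPath Λ // G.deg l.hom ≠ 0}

/-- The generators: vertices, paths of nonzero degree, and a ghost path `l*` for every path `l` of
nonzero degree. -/
inductive Gen (G : KGraph k Λ) : Type (max u v)
  | vertex (a : Λ)
  | path (l : G.NonzeroPath)
  | ghost (l : G.NonzeroPath)

/-- The free (associative, non-unital) `R`-algebra on the generators: the free `R`-module on the
nonempty words, multiplied by concatenation of words. -/
abbrev FreeAlg (G : KGraph k Λ) (R : Type w) [CommRing R] : Type (max u v w) :=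
  MonoidAlgebra R (FreeSemigroup G.Gen)

/-- A generator as an element of the free algebra. -/
noncomputable def gen (G : KGraph k Λ) (R : Type w) [CommRing R] (x : G.Gen) : G.FreeAlg R :=
  MonoidAlgebra.single (FreeSemigroup.of x) 1

theorem RowFinite.finite_nonzero {G : KGraph k Λ} (hG : G.RowFinite) (a : Λ) (n : Fin k → ℕ) :
    {l : G.NonzeroPath | l.1 ∈ G.pathsTo a n}.Finite :=
  (hG a n).preimage Subtype.val_injective.injOn

/-- The Kumjian-Pask relations, `KPRel hG R x y` meaning that `x = y` is one of them. -/
inductive KPRel {G : KGraph k Λ} (hG : G.RowFinite) (R : Type w) [CommRing R] :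
    G.FreeAlg R → G.FreeAlg R → Prop
  /-- (KP1) the vertices are idempotents -/
  | vertex_idem (a : Λ) :
      KPRel hG R (G.gen R (.vertex a) * G.gen R (.vertex a)) (G.gen R (.vertex a))
  /-- (KP1) the vertices are mutually orthogonal -/
  | vertex_orth (a b : Λ) (h : a ≠ b) :
      KPRel hG R (G.gen R (.vertex a) * G.gen R (.vertex b)) 0
  /-- (KP2) products of composable paths; here `f` is `μ`, `g` is `ν` and `g ≫ f` is `μν` -/
  | path_mul {a b c : Λ} (f : b ⟶ c) (g : a ⟶ b) (hf : G.deg f ≠ 0) (hg : G.deg g ≠ 0)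
      (hfg : G.deg (g ≫ f) ≠ 0) :
      KPRel hG R (G.gen R (.path ⟨⟨b, c, f⟩, hf⟩) * G.gen R (.path ⟨⟨a, b, g⟩, hg⟩))
        (G.gen R (.path ⟨⟨a, c, g ≫ f⟩, hfg⟩))
  /-- (KP2) products of composable ghost paths -/
  | ghost_mul {a b c : Λ} (f : b ⟶ c) (g : a ⟶ b) (hf : G.deg f ≠ 0) (hg : G.deg g ≠ 0)
      (hfg : G.deg (g ≫ f) ≠ 0) :
      KPRel hG R (G.gen R (.ghost ⟨⟨a, b, g⟩, hg⟩) * G.gen R (.ghost ⟨⟨b, c, f⟩, hf⟩))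
        (G.gen R (.ghost ⟨⟨a, c, g ≫ f⟩, hfg⟩))
  /-- (KP2) `r(l) l = l` -/
  | range_path (l : G.NonzeroPath) :
      KPRel hG R (G.gen R (.vertex l.1.tgt) * G.gen R (.path l)) (G.gen R (.path l))
  /-- (KP2) `l s(l) = l` -/
  | path_source (l : G.NonzeroPath) :
      KPRel hG R (G.gen R (.path l) * G.gen R (.vertex l.1.src)) (G.gen R (.path l))
  /-- (KP2) `s(l) l* = l*` -/
  | source_ghost (l : G.NonzeroPath) :
      KPRel hG R (G.gen R (.vertex l.1.src) * G.gen R (.ghost l)) (G.gen R (.ghost l))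
  /-- (KP2) `l* r(l) = l*` -/
  | ghost_range (l : G.NonzeroPath) :
      KPRel hG R (G.gen R (.ghost l) * G.gen R (.vertex l.1.tgt)) (G.gen R (.ghost l))
  /-- (KP3) `l* l = s(l)` -/
  | ghost_path_self (l : G.NonzeroPath) :
      KPRel hG R (G.gen R (.ghost l) * G.gen R (.path l)) (G.gen R (.vertex l.1.src))
  /-- (KP3) `l* m = 0` for different paths `l` and `m` of the same degree -/
  | ghost_path_ne (l m : G.NonzeroPath) (hd : G.deg l.1.hom = G.deg m.1.hom) (h : l ≠ m) :
      KPRel hG R (G.gen R (.ghost l) * G.gen R (.path m)) 0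
  /-- (KP4) `a` is the sum of `l l*` over the paths `l` of degree `n ≠ 0` with range `a` -/
  | vertex_sum (a : Λ) (n : Fin k → ℕ) (hn : n ≠ 0) :
      KPRel hG R (G.gen R (.vertex a))
        (∑ l ∈ (hG.finite_nonzero a n).toFinset, G.gen R (.path l) * G.gen R (.ghost l))

/-- The algebra ideal of the free algebra generated by the Kumjian-Pask relations.  The free algebra
has no unit, so the ring ideal is generated by all `R`-multiples of the relators. -/
noncomputable def kpIdeal {G : KGraph k Λ} (hG : G.RowFinite) (R : Type w) [CommRing R] :
    TwoSidedIdeal (G.FreeAlg R) :=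
  TwoSidedIdeal.span {z | ∃ (t : R) (x y : G.FreeAlg R), KPRel hG R x y ∧ z = t • (x - y)}

/-- The Kumjian-Pask algebra `KP_R(Λ)` of a row-finite `k`-graph: the quotient of the free algebra
by the Kumjian-Pask relations.  It is a ring that need not have a unit. -/
def KP {G : KGraph k Λ} (hG : G.RowFinite) (R : Type w) [CommRing R] : Type (max u v w) :=
  (kpIdeal hG R).ringCon.Quotient

namespace KP

variable {G : KGraph k Λ} (hG : G.RowFinite) (R : Type w) [CommRing R]

noncomputable instance : NonUnitalRing (KP hG R) :=
  inferInstanceAs (NonUnitalRing (kpIdeal hG R).ringCon.Quotient)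

/-- The quotient map from the free algebra. -/
noncomputable def mk (x : G.FreeAlg R) : KP hG R := (x : (kpIdeal hG R).ringCon.Quotient)

theorem smul_mem (t : R) {z : G.FreeAlg R} (hz : z ∈ kpIdeal hG R) : t • z ∈ kpIdeal hG R := by
  induction hz using TwoSidedIdeal.span_induction with
  | mem z hz =>
    obtain ⟨r, x, y, h, rfl⟩ := hz
    exact TwoSidedIdeal.subset_span ⟨t * r, x, y, h, (mul_smul t r _).symm⟩
  | zero => rw [smul_zero]; exact TwoSidedIdeal.zero_mem _
  | add x y _ _ hx hy => rw [smul_add]; exact TwoSidedIdeal.add_mem _ hx hy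
  | neg x _ hx => rw [smul_neg]; exact TwoSidedIdeal.neg_mem _ hx
  | left_absorb a x _ hx => rw [← mul_smul_comm]; exact TwoSidedIdeal.mul_mem_left _ _ _ hx
  | right_absorb a x _ hx => rw [← smul_mul_assoc]; exact TwoSidedIdeal.mul_mem_right _ _ _ hx

theorem smul_rel (t : R) {x y : G.FreeAlg R} (h : (kpIdeal hG R).ringCon x y) :
    (kpIdeal hG R).ringCon (t • x) (t • y) := by
  rw [TwoSidedIdeal.rel_iff] at h ⊢
  rw [← smul_sub]
  exact smul_mem hG R t h

noncomputable instance : SMul R (KP hG R) where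
  smul t := Quotient.map (t • ·) fun _ _ h => smul_rel hG R t h

theorem mk_surjective : Function.Surjective (mk hG R) := Quotient.mk_surjective

/-- The `R`-module structure on `KP_R(Λ)`. -/
noncomputable instance : Module R (KP hG R) :=
  Function.Surjective.module R
    (⟨⟨mk hG R, rfl⟩, fun _ _ => rfl⟩ : G.FreeAlg R →+ KP hG R)
    (mk_surjective hG R) fun _ _ => rfl

instance : IsScalarTower R (KP hG R) (KP hG R) where
  smul_assoc t x y := by
    obtain ⟨x, rfl⟩ := mk_surjective hG R x
    obtain ⟨y, rfl⟩ := mk_surjective hG R y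
    exact congrArg (mk hG R) (smul_mul_assoc t x y)

instance : SMulCommClass R (KP hG R) (KP hG R) where
  smul_comm t x y := by
    obtain ⟨x, rfl⟩ := mk_surjective hG R x
    obtain ⟨y, rfl⟩ := mk_surjective hG R y
    exact congrArg (mk hG R) (mul_smul_comm t x y).symm

end KP

end KGraph

/-! ### Finite paths: consequences of unique factorization. -/

namespace KGraph

section Paths

variable {k : ℕ} {Λ : Type u} [Category.{v} Λ] (G : KGraph k Λ)

/-! Let paths act on a set so that every element factors uniquely through a path of each degree (a
`PathSpace`). The Kumjian–Pask algebra then acts on the free module over that set: paths act by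
partial injections, ghost paths by their inverses. Infinite paths are such a set, nonempty over
every vertex, so `t • p_a ≠ 0` whenever `t ≠ 0`.

If the algebra is simple, its representation on any nonempty path space is faithful, and each
condition comes from a suitable ideal or space. For `r ≠ 0` the ideal of `r`-multiples is
everything, and a diagonal matrix coefficient of `p_a = r z` gives an inverse of `r`. If cofinality
fails for a vertex `a`, the infinite paths from whose vertices `a` cannot be reached form a nonempty
path space on which `p_a` acts as zero. If aperiodicity fails at `a` for `m ≠ n`, all infinite paths
with range `a` have equal shifts by `m` and `n`. This produces paths `f`, `g` of different degrees
that act identically on infinite paths, so `s_f s_{f*} - s_g s_{f*}` acts as zero there. It does not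
act as zero on the product with `ℤᵏ`, which records degrees.

Conversely, every element is a combination of terms `s_f s_{g*}` in which all `g` have one degree
(`KP.exists_mem_level`). Aperiodicity yields a path `l` such that multiplication by `s_{(fl)*}` on
the left and `s_{gl}` on the right turns a chosen term into a multiple of a vertex and kills the
others (`KP.exists_mul_mul_eq_smul_p`). Over a field, a nonzero ideal thus contains a vertex. If it
missed another vertex, (KP4) would give an infinite path all of whose vertices it misses, against
cofinality (`Cofinal.p_mem`). So it contains all vertices, which generate the algebra as an ideal.
-/

theorem exists_fac {a c : Λ} (f : a ⟶ c) {m : Fin k → ℕ} (hm : m ≤ G.deg f) :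
    ∃ (b : Λ) (g : b ⟶ c) (h : a ⟶ b), G.deg g = m ∧ G.deg h = G.deg f - m ∧ h ≫ g = f := by
  obtain ⟨⟨b, g, h⟩, ⟨h1, h2, h3⟩, -⟩ :=
    G.factorization f m (G.deg f - m) (add_tsub_cancel_of_le hm).symm
  exact ⟨b, g, h, h1, h2, h3⟩

/-- Comparing the degrees of the factors at the range suffices: additivity and cancellation in `ℕᵏ`
give the others. -/
theorem fac_unique {a c b b' : Λ} {g : b ⟶ c} {h : a ⟶ b} {g' : b' ⟶ c} {h' : a ⟶ b'}
    (hd : G.deg g = G.deg g') (e : h ≫ g = h' ≫ g') :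
    (⟨b, g, h⟩ : Σ b : Λ, (b ⟶ c) × (a ⟶ b)) = ⟨b', g', h'⟩ := by
  have hdeg := congrArg G.deg e
  rw [G.deg_comp, G.deg_comp, hd] at hdeg
  have hh : G.deg h = G.deg h' := add_right_cancel hdeg
  exact (G.factorization (h ≫ g) (G.deg g) (G.deg h) (by rw [G.deg_comp, add_comm])).unique
    ⟨rfl, rfl, rfl⟩ ⟨hd.symm, hh.symm, e.symm⟩

theorem cancel_right (G : KGraph k Λ) {a b c : Λ} {h h' : a ⟶ b} {g : b ⟶ c}
    (e : h ≫ g = h' ≫ g) : h = h' := by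
  simpa using G.fac_unique rfl e

theorem cancel_left (G : KGraph k Λ) {a b c : Λ} {h : a ⟶ b} {g g' : b ⟶ c}
    (e : h ≫ g = h ≫ g') : g = g' := by
  have hdeg := congrArg G.deg e
  rw [G.deg_comp, G.deg_comp] at hdeg
  simpa using G.fac_unique (add_left_cancel hdeg) e

/-- Both `f` and `𝟙 b` are range-side factors of `f` of degree `0`, hence they coincide. The form is
that of an induction principle because `f = 𝟙 b` is not well typed before the two objects are
identified. -/
theorem eq_id_of_deg_eq_zero {b : Λ} {motive : ∀ {a : Λ}, (a ⟶ b) → Prop} (h : motive (𝟙 b))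
    {a : Λ} (f : a ⟶ b) (hf : G.deg f = 0) : motive f := by
  have := G.fac_unique (g := f) (h := 𝟙 a) (g' := 𝟙 b) (h' := f)
    (by rw [hf, G.deg_id]) (by simp)
  obtain ⟨rfl, h2⟩ := Sigma.mk.inj this
  obtain ⟨rfl, -⟩ := Prod.mk.inj (eq_of_heq h2)
  exact h

/-- `s` is an initial segment of `t`. -/
def IsInitial {a : Λ} (s t : Σ b : Λ, (b ⟶ a)) : Prop := ∃ h : t.1 ⟶ s.1, h ≫ s.2 = t.2

theorem IsInitial.trans {a : Λ} {s t r : Σ b : Λ, (b ⟶ a)} (h₁ : IsInitial s t)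
    (h₂ : IsInitial t r) : IsInitial s r := by
  obtain ⟨p, hp⟩ := h₁
  obtain ⟨q, hq⟩ := h₂
  exact ⟨q ≫ p, by rw [Category.assoc, hp, hq]⟩

theorem IsInitial.unique {a : Λ} {s s' t : Σ b : Λ, (b ⟶ a)} (h : IsInitial s t)
    (h' : IsInitial s' t) (hd : G.deg s.2 = G.deg s'.2) : s = s' := by
  obtain ⟨b, s⟩ := s
  obtain ⟨b', s'⟩ := s'
  obtain ⟨p, hp⟩ := h
  obtain ⟨q, hq⟩ := h'
  have := G.fac_unique hd (hp.trans hq.symm)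
  obtain ⟨rfl, h2⟩ := Sigma.mk.inj this
  obtain ⟨rfl, -⟩ := Prod.mk.inj (eq_of_heq h2)
  rfl

theorem IsInitial.comp_right {a c : Λ} {s t : Σ b : Λ, (b ⟶ a)} (h : IsInitial s t) (f : a ⟶ c) :
    IsInitial (⟨s.1, s.2 ≫ f⟩ : Σ b : Λ, (b ⟶ c)) ⟨t.1, t.2 ≫ f⟩ := by
  obtain ⟨p, hp⟩ := h
  exact ⟨p, by simp only [← Category.assoc, hp]⟩

theorem exists_isInitial {a : Λ} (t : Σ b : Λ, (b ⟶ a)) {m : Fin k → ℕ} (hm : m ≤ G.deg t.2) :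
    ∃ s : Σ b : Λ, (b ⟶ a), G.deg s.2 = m ∧ IsInitial s t := by
  obtain ⟨b, g, h, h1, -, h3⟩ := G.exists_fac t.2 hm
  exact ⟨⟨b, g⟩, h1, h, h3⟩

/-- Initial segments of the same path are comparable as soon as their degrees are. -/
theorem IsInitial.of_deg_le {a : Λ} {s s' t : Σ b : Λ, (b ⟶ a)} (h : IsInitial s t)
    (h' : IsInitial s' t) (hd : G.deg s.2 ≤ G.deg s'.2) : IsInitial s s' := by
  obtain ⟨r, hr, hr'⟩ := G.exists_isInitial s' hd
  rwa [IsInitial.unique G h (hr'.trans h') hr.symm]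

/-! ### Infinite paths: prefixing, shifting, construction from finite pieces. -/

/-- An infinite path with range `a`, given by the coherent family of its initial segments. -/
@[ext]
structure PathFamily (a : Λ) where
  /-- the initial segment of degree `p` -/
  path : (Fin k → ℕ) → Σ b : Λ, (b ⟶ a)
  deg_path : ∀ p, G.deg (path p).2 = p
  coherent : ∀ p q, p ≤ q → IsInitial (path p) (path q)

namespace PathFamily

variable {G}

theorem exists_act {a c : Λ} (f : a ⟶ c) (x : G.PathFamily a) (p : Fin k → ℕ) :
    ∃ s : Σ b : Λ, (b ⟶ c), G.deg s.2 = p ∧ IsInitial s ⟨(x.path p).1, (x.path p).2 ≫ f⟩ :=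
  G.exists_isInitial _ (by dsimp only; rw [G.deg_comp, x.deg_path]; exact le_self_add)

/-- The infinite path `fx`. -/
noncomputable def act {a c : Λ} (f : a ⟶ c) (x : G.PathFamily a) : G.PathFamily c where
  path p := (exists_act f x p).choose
  deg_path p := (exists_act f x p).choose_spec.1
  coherent p q hpq := by
    refine IsInitial.of_deg_le G
      ((exists_act f x p).choose_spec.2.trans ((x.coherent p q hpq).comp_right f))
      (exists_act f x q).choose_spec.2 ?_
    rwa [(exists_act f x p).choose_spec.1, (exists_act f x q).choose_spec.1]

theorem act_isInitial {a c : Λ} (f : a ⟶ c) (x : G.PathFamily a) (p : Fin k → ℕ) :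
    IsInitial ((act f x).path p) ⟨(x.path p).1, (x.path p).2 ≫ f⟩ :=
  (exists_act f x p).choose_spec.2

theorem act_path_eq {a c : Λ} (f : a ⟶ c) (x : G.PathFamily a) {s : Σ b : Λ, (b ⟶ c)}
    {q : Fin k → ℕ} (h : IsInitial s ⟨(x.path q).1, (x.path q).2 ≫ f⟩)
    (hq : G.deg s.2 ≤ q) : (act f x).path (G.deg s.2) = s :=
  IsInitial.unique G (((act f x).coherent _ _ hq).trans (act_isInitial f x q)) h
    ((act f x).deg_path _)

theorem act_eq_iff {a c : Λ} (f : a ⟶ c) (x : G.PathFamily a) (y : G.PathFamily c) :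
    act f x = y ↔ ∀ p, IsInitial (y.path p) ⟨(x.path p).1, (x.path p).2 ≫ f⟩ := by
  refine ⟨fun h p => h ▸ act_isInitial f x p, fun h => ?_⟩
  ext1
  funext p
  exact IsInitial.unique G (act_isInitial f x p) (h p) (by rw [deg_path, deg_path])

theorem act_comp {a b c : Λ} (g : a ⟶ b) (f : b ⟶ c) (x : G.PathFamily a) :
    act (g ≫ f) x = act f (act g x) := by
  rw [act_eq_iff]
  intro p
  refine (act_isInitial f (act g x) p).trans ?_
  simpa only [Category.assoc] using (act_isInitial g x p).comp_right f

/-- The segment of degree `deg f + p` of `fx` is `f` followed by that of degree `p` of `x`. -/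
theorem act_path_add {a c : Λ} (f : a ⟶ c) (x : G.PathFamily a) (p : Fin k → ℕ) :
    (act f x).path (p + G.deg f) = ⟨(x.path p).1, (x.path p).2 ≫ f⟩ := by
  have h := act_path_eq f x (q := p + G.deg f) (s := ⟨(x.path p).1, (x.path p).2 ≫ f⟩)
    ((x.coherent p _ le_self_add).comp_right f) (by rw [G.deg_comp, x.deg_path])
  rwa [G.deg_comp, x.deg_path] at h

theorem act_path_deg {a c : Λ} (f : a ⟶ c) (x : G.PathFamily a) :
    (act f x).path (G.deg f) = ⟨a, f⟩ :=
  act_path_eq f x (s := ⟨a, f⟩) (q := G.deg f) ⟨_, rfl⟩ le_rfl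

/-- Past degree `deg f`, the segments of `fx` are `f` followed by those of `x`, and `f` cancels. -/
theorem act_injective {a c : Λ} (f : a ⟶ c) : Function.Injective (act (G := G) f) := by
  intro x y h
  ext1
  funext p
  have h2 := congrArg (fun z => z.path (p + G.deg f)) h
  rw [act_path_add, act_path_add] at h2
  generalize x.path p = s at *
  generalize y.path p = t at *
  obtain ⟨b, s⟩ := s
  obtain ⟨b', t⟩ := t
  obtain ⟨h3, h4⟩ := Sigma.mk.inj h2
  dsimp only at h3 h4
  subst h3
  rw [G.cancel_right (eq_of_heq h4)]

/-- The segments of the tail are those of `x` of degree `p + n` with the first `n` removed;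
cancelling the common initial segment makes them coherent. -/
theorem exists_shift {c : Λ} (x : G.PathFamily c) (n : Fin k → ℕ) :
    ∃ y : G.PathFamily (x.path n).1, act (x.path n).2 y = x := by
  choose h hh using fun p => x.coherent n (p + n) le_add_self
  refine ⟨⟨fun p => ⟨(x.path (p + n)).1, h p⟩, fun p => ?_, fun p q hpq => ?_⟩, ?_⟩
  · have := congrArg G.deg (hh p)
    rw [G.deg_comp, x.deg_path, x.deg_path] at this
    exact add_right_cancel this
  · obtain ⟨e, he⟩ := x.coherent (p + n) (q + n) (add_le_add hpq le_rfl)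
    refine ⟨e, G.cancel_right (g := (x.path n).2) ?_⟩
    dsimp only
    rw [Category.assoc, hh, hh, he]
  · rw [act_eq_iff]
    intro p
    rw [hh]
    exact x.coherent _ _ le_self_add

theorem existsUnique_act {c : Λ} (x : G.PathFamily c) (n : Fin k → ℕ) :
    ∃! t : (Σ a : Λ, (a ⟶ c) × G.PathFamily a), G.deg t.2.1 = n ∧ act t.2.1 t.2.2 = x := by
  obtain ⟨y, hy⟩ := x.exists_shift n
  refine ⟨⟨_, _, y⟩, ⟨x.deg_path n, hy⟩, ?_⟩
  rintro ⟨a, f, z⟩ ⟨hf, hz⟩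
  dsimp only at hf hz
  have h := act_path_deg f z
  rw [hf, hz] at h
  generalize x.path n = s at *
  subst h
  rw [act_injective f (hz.trans hy.symm)]

/-- The infinite path as a functor on `Ω_k`. -/
noncomputable def toInfinitePath {c : Λ} (x : G.PathFamily c) : G.InfinitePath where
  toFunctor :=
    { obj := fun p => (x.path p.pt).1
      map := fun {q p} f => (x.coherent p.pt q.pt f.down).choose
      map_id := fun p => G.cancel_right (g := (x.path p.pt).2) (by
        rw [(x.coherent p.pt p.pt le_rfl).choose_spec, Category.id_comp])
      map_comp := fun {r q p} f g => G.cancel_right (g := (x.path p.pt).2) (by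
        rw [(x.coherent p.pt r.pt (g.down.trans f.down)).choose_spec, Category.assoc,
          (x.coherent p.pt q.pt g.down).choose_spec, (x.coherent q.pt r.pt f.down).choose_spec]) }
  deg_map {q p} f := by
    have := congrArg G.deg (x.coherent p.pt q.pt f.down).choose_spec
    rw [G.deg_comp, x.deg_path, x.deg_path] at this
    exact eq_tsub_of_add_eq this

/-- The initial segments of an infinite path. -/
def ofInfinitePath (x : G.InfinitePath) : G.PathFamily (x.vertex 0) where
  path p := ⟨x.vertex p, x.toFunctor.map (X := ⟨p⟩) (Y := ⟨0⟩) ⟨fun _ => Nat.zero_le _⟩⟩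
  deg_path p := (x.deg_map _).trans (tsub_zero p)
  coherent p q hpq := ⟨x.toFunctor.map (X := ⟨q⟩) (Y := ⟨p⟩) ⟨hpq⟩,
    (x.toFunctor.map_comp (X := ⟨q⟩) (Y := ⟨p⟩) (Z := ⟨0⟩) _ _).symm⟩

/-- A sequence of composable paths whose degrees are at least `(1, …, 1)` composes to an infinite
path, whose initial segments are initial segments of finite composites. -/
theorem exists_of_sequence (c : ℕ → Λ) (f : ∀ i, c (i + 1) ⟶ c i) (hf : ∀ i, 1 ≤ G.deg (f i)) :
    ∃ x : G.PathFamily (c 0), ∀ p, ∃ i, Nonempty (c i ⟶ (x.path p).1) := by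
  let F : ∀ i, c i ⟶ c 0 := fun i => Nat.rec (𝟙 _) (fun i g => f i ≫ g) i
  have hdeg : ∀ i : ℕ, ∀ j, i ≤ G.deg (F i) j := by
    intro i
    induction i with
    | zero => exact fun j => Nat.zero_le _
    | succ i ih =>
      intro j
      change i + 1 ≤ G.deg (f i ≫ F i) j
      rw [G.deg_comp, Pi.add_apply]
      have h1 := ih j
      have h2 : 1 ≤ G.deg (f i) j := hf i j
      omega
  have hini : ∀ i j, i ≤ j → IsInitial (⟨c i, F i⟩ : Σ b : Λ, (b ⟶ c 0)) ⟨c j, F j⟩ := by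
    intro i j hij
    induction j, hij using Nat.le_induction with
    | base => exact ⟨𝟙 _, Category.id_comp _⟩
    | succ j _ ih => exact ih.trans ⟨f j, rfl⟩
  -- The sum of the coordinates bounds each of them, and it is monotone in `p`, which gives
  -- coherence below.
  have hle : ∀ p : Fin k → ℕ, p ≤ G.deg (F (∑ j, p j)) := fun p j =>
    (Finset.single_le_sum (fun _ _ => Nat.zero_le _) (Finset.mem_univ j)).trans (hdeg _ j)
  choose s hs hs' using fun p => G.exists_isInitial ⟨_, F (∑ j, p j)⟩ (hle p)
  refine ⟨⟨s, hs, fun p q hpq => ?_⟩, fun p => ⟨_, ⟨(hs' p).choose⟩⟩⟩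
  refine IsInitial.of_deg_le G ((hs' p).trans (hini _ _ (Finset.sum_le_sum fun j _ => hpq j)))
    (hs' q) ?_
  rwa [hs, hs]

theorem nonempty (hG : G.NoSources) (a : Λ) : Nonempty (G.PathFamily a) := by
  choose l hl hd using fun a => hG a 1
  have key : ∀ a, ∃ (b : Λ) (f : b ⟶ a), G.deg f = 1 := by
    intro a
    have h1 := hl a
    have h2 := hd a
    generalize l a = m at *
    subst h1
    exact ⟨_, _, h2⟩
  choose b f hf using key
  obtain ⟨x, -⟩ := exists_of_sequence (G := G) (fun i => b^[i] a)
    -- `b^[i + 1] a` unfolds to `b^[i] (b a)`, so its equality with `b (b^[i] a)` has to be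
    -- transported along.
    (fun i => eqToHom (Function.iterate_succ_apply' b i a) ≫ f (b^[i] a)) (fun i => by
      rw [G.deg_comp, hf]; exact le_add_self)
  exact ⟨x⟩

end PathFamily

/-! ### Aperiodicity and its failure. -/

variable {G}

theorem segment_spec (l : CatPath Λ) (p q : Fin k → ℕ) (hpq : p ≤ q) (hq : q ≤ G.deg l.hom) :
    G.deg (G.segment l p q hpq hq).hom = q - p ∧
      ∃ (a : (G.segment l p q hpq hq).tgt ⟶ l.tgt) (c : l.src ⟶ (G.segment l p q hpq hq).src),
        G.deg a = p ∧ c ≫ (G.segment l p q hpq hq).hom ≫ a = l.hom :=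
  (G.existsUnique_segment l p q hpq hq).choose_spec.1

theorem segment_eq (l : CatPath Λ) (p q : Fin k → ℕ) (hpq : p ≤ q) (hq : q ≤ G.deg l.hom)
    {b c : Λ} (e : b ⟶ c) (he : G.deg e = q - p) (a : c ⟶ l.tgt) (d : l.src ⟶ b)
    (ha : G.deg a = p) (h : d ≫ e ≫ a = l.hom) : G.segment l p q hpq hq = ⟨b, c, e⟩ :=
  (G.existsUnique_segment l p q hpq hq).unique (segment_spec l p q hpq hq) ⟨he, a, d, ha, h⟩

/-- If aperiodicity fails at `a` for `m` and `n`, then all infinite paths `x` with range `a`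
satisfy `σᵐ(x) = σⁿ(x)`. -/
theorem shift_eq_shift {a : Λ} {m n : Fin k → ℕ}
    (H : ∀ (l : CatPath Λ) (_ : l.tgt = a) (h : m ⊔ n ≤ G.deg l.hom),
      G.segment l m (m + (G.deg l.hom - (m ⊔ n))) le_self_add (segment_bound h m le_sup_left) =
      G.segment l n (n + (G.deg l.hom - (m ⊔ n))) le_self_add (segment_bound h n le_sup_right))
    {b c : Λ} (f : b ⟶ a) (g : c ⟶ a) (hf : G.deg f = m) (hg : G.deg g = n)
    (y : G.PathFamily b) (z : G.PathFamily c) (h : y.act f = z.act g) :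
    (⟨b, y⟩ : Σ b, G.PathFamily b) = ⟨c, z⟩ := by
  have key : ∀ p, (⟨(y.path p).1, b, (y.path p).2⟩ : CatPath Λ) =
      ⟨(z.path p).1, c, (z.path p).2⟩ := by
    intro p
    -- For a path of degree `(m ⊔ n) + p` the two segments compared in `H` have degree exactly `p`:
    -- they are the initial segments of `y` and of `z`.
    let t := (y.act f).path (m ⊔ n + p)
    have ht : G.deg t.2 = m ⊔ n + p := PathFamily.deg_path _ _
    have hsub : G.deg t.2 - (m ⊔ n) = p := by rw [ht, add_tsub_cancel_left]
    have := H ⟨t.1, a, t.2⟩ rfl (by rw [ht]; exact le_self_add)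
    obtain ⟨d, hd⟩ : IsInitial ⟨(y.path p).1, (y.path p).2 ≫ f⟩ t := by
      rw [← PathFamily.act_path_add]
      refine PathFamily.coherent _ _ _ ?_
      rw [hf, add_comm]
      exact add_le_add le_sup_left le_rfl
    obtain ⟨d', hd'⟩ : IsInitial ⟨(z.path p).1, (z.path p).2 ≫ g⟩ t := by
      rw [← PathFamily.act_path_add, ← h]
      refine PathFamily.coherent _ _ _ ?_
      rw [hg, add_comm]
      exact add_le_add le_sup_right le_rfl
    rw [segment_eq _ _ _ _ _ (y.path p).2 (by rw [hsub, add_tsub_cancel_left, y.deg_path]) f d hf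
      hd, segment_eq _ _ _ _ _ (z.path p).2 (by rw [hsub, add_tsub_cancel_left, z.deg_path]) g d'
      hg hd'] at this
    exact this
  obtain rfl : b = c := congrArg CatPath.tgt (key 0)
  congr 1
  ext1
  funext p
  have := key p
  generalize y.path p = s at *
  generalize z.path p = t at *
  obtain ⟨_, s⟩ := s
  obtain ⟨_, t⟩ := t
  simp only [CatPath.mk.injEq] at this
  obtain ⟨rfl, -, h2⟩ := this
  rw [eq_of_heq h2]

/-- In an aperiodic `k`-graph, different paths `f` and `g` with the same source have extensions
`fl` and `gl` that have no common extension. -/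
theorem Aperiodic.exists_separating (hG : G.Aperiodic) {a b c : Λ} (f : a ⟶ b) (g : a ⟶ c)
    (hfg : (⟨a, b, f⟩ : CatPath Λ) ≠ ⟨a, c, g⟩) :
    ∃ (d : Λ) (l : d ⟶ a), ∀ (e : Λ) (p q : e ⟶ d),
      (⟨e, b, p ≫ l ≫ f⟩ : CatPath Λ) ≠ ⟨e, c, q ≫ l ≫ g⟩ := by
  by_cases hbc : b = c
  · subst hbc
    by_cases hd : G.deg f = G.deg g
    · refine ⟨a, 𝟙 a, fun e p q h => hfg ?_⟩
      simp only [CatPath.mk.injEq, heq_eq_eq, true_and, Category.id_comp] at h ⊢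
      have := G.fac_unique hd h
      simp only [Sigma.mk.injEq, heq_eq_eq, Prod.mk.injEq, true_and] at this
      exact this.1
    · obtain ⟨l, rfl, hl, hne⟩ := hG a (G.deg f) (G.deg g) hd
      refine ⟨l.src, l.hom, fun e p q h => hne ?_⟩
      simp only [CatPath.mk.injEq, heq_eq_eq, true_and] at h
      obtain ⟨h1, a₁, c₁, ha₁, hl₁⟩ := segment_spec l _ _ le_self_add
        (segment_bound hl (G.deg f) le_sup_left)
      obtain ⟨h2, a₂, c₂, ha₂, hl₂⟩ := segment_spec l _ _ le_self_add
        (segment_bound hl (G.deg g) le_sup_right)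
      -- A common extension has one segment starting at `deg f + deg g`. Read through `f` it is
      -- `l(deg g, ·)`, read through `g` it is `l(deg f, ·)`; so these would coincide.
      have hx : G.deg f + G.deg g + (G.deg l.hom - (G.deg f ⊔ G.deg g)) ≤
          G.deg (p ≫ l.hom ≫ f) := by
        rw [G.deg_comp, G.deg_comp, add_assoc, add_comm]
        exact (add_le_add (segment_bound hl _ le_sup_right) le_rfl).trans le_add_self
      refine (G.existsUnique_segment ⟨e, b, p ≫ l.hom ≫ f⟩ (G.deg f + G.deg g) _
        le_self_add hx).unique ⟨?_, a₁ ≫ g, q ≫ c₁, ?_, ?_⟩ ⟨?_, a₂ ≫ f, p ≫ c₂, ?_, ?_⟩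
      · rw [add_tsub_cancel_left]
        exact h1.trans (add_tsub_cancel_left _ _)
      · rw [G.deg_comp, ha₁]
      · dsimp only
        rw [h, ← reassoc_of% hl₁, Category.assoc]
      · rw [add_tsub_cancel_left]
        exact h2.trans (add_tsub_cancel_left _ _)
      · rw [G.deg_comp, ha₂, add_comm]
      · dsimp only
        rw [← reassoc_of% hl₂, Category.assoc]
  · exact ⟨a, 𝟙 a, fun e p q h => hbc (congrArg CatPath.tgt h)⟩

/-- One path separates `f` from finitely many other paths. -/
theorem Aperiodic.exists_separating_finset (hG : G.Aperiodic) {a b : Λ} (f : a ⟶ b)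
    (s : Finset (Σ c : Λ, (a ⟶ c))) (hs : ⟨b, f⟩ ∉ s) :
    ∃ (d : Λ) (l : d ⟶ a), ∀ g ∈ s, ∀ (e : Λ) (p q : e ⟶ d),
      (⟨e, b, p ≫ l ≫ f⟩ : CatPath Λ) ≠ ⟨e, g.1, q ≫ l ≫ g.2⟩ := by
  classical
  induction s using Finset.induction_on with
  | empty => exact ⟨a, 𝟙 a, by simp⟩
  | insert g s _ ih =>
    rw [Finset.mem_insert, not_or] at hs
    obtain ⟨d, l, hl⟩ := ih hs.2
    -- Prolonging `l` keeps the separations already achieved, so it remains to separate `fl` from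
    -- `gl`, which are still different by cancellation.
    have hne : (⟨d, b, l ≫ f⟩ : CatPath Λ) ≠ ⟨d, g.1, l ≫ g.2⟩ := by
      intro h
      apply hs.1
      obtain ⟨c, g⟩ := g
      simp only [CatPath.mk.injEq, true_and] at h
      obtain ⟨rfl, h2⟩ := h
      rw [G.cancel_left (eq_of_heq h2)]
    obtain ⟨d', l', hl'⟩ := hG.exists_separating _ _ hne
    refine ⟨d', l' ≫ l, fun g' hg' e p q => ?_⟩
    rcases Finset.mem_insert.1 hg' with rfl | hg'
    · simpa only [Category.assoc] using hl' e p q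
    · simpa only [Category.assoc] using hl g' hg' e (p ≫ l') (q ≫ l')

end Paths

end KGraph

/-! ### Representations on path spaces. -/

namespace KGraph

section Representations

variable {k : ℕ} {Λ : Type u} [Category.{v} Λ]

/-- A set with an action of the paths of a `k`-graph, in which every element factors uniquely
through a path of any given degree.  Infinite paths are the main example. -/
structure PathSpace (G : KGraph k Λ) where
  /-- the elements with range `a` -/
  fiber : Λ → Type w
  /-- the action of a path -/
  act : ∀ {a b : Λ}, (a ⟶ b) → fiber a → fiber b
  act_comp : ∀ {a b c : Λ} (g : a ⟶ b) (f : b ⟶ c) (x : fiber a),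
    act (g ≫ f) x = act f (act g x)
  existsUnique_act : ∀ {b : Λ} (x : fiber b) (n : Fin k → ℕ),
    ∃! t : (Σ a : Λ, (a ⟶ b) × fiber a), G.deg t.2.1 = n ∧ act t.2.1 t.2.2 = x

namespace PathSpace

variable {G : KGraph k Λ}

/-- The space of infinite paths. -/
noncomputable def infinitePaths (G : KGraph k Λ) : G.PathSpace where
  fiber := G.PathFamily
  act := PathFamily.act
  act_comp := PathFamily.act_comp
  existsUnique_act := PathFamily.existsUnique_act

/-- The product of a path space with `ℤᵏ`, on which a path acts by adding its degree. -/
def graded (F : G.PathSpace) : G.PathSpace where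
  fiber a := F.fiber a × (Fin k → ℤ)
  act f x := (F.act f x.1, x.2 + fun i => (G.deg f i : ℤ))
  act_comp g f x := by
    rw [F.act_comp, G.deg_comp]
    refine Prod.ext rfl (funext fun i => ?_)
    simp only [Pi.add_apply, Nat.cast_add]
    ring
  existsUnique_act {b} x n := by
    obtain ⟨x, z⟩ := x
    obtain ⟨⟨a, f, y⟩, ⟨hf, hy⟩, hu⟩ := F.existsUnique_act x n
    refine ⟨⟨a, f, y, z - fun i => (n i : ℤ)⟩, ⟨hf, ?_⟩, ?_⟩
    · dsimp only at *
      rw [hf, hy, sub_add_cancel]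
    · rintro ⟨a', f', y', z'⟩ ⟨hf', hy'⟩
      dsimp only at *
      obtain ⟨hy', hz'⟩ := Prod.mk.inj hy'
      have := hu ⟨a', f', y'⟩ ⟨hf', hy'⟩
      obtain ⟨rfl, h2⟩ := Sigma.mk.inj this
      obtain ⟨rfl, rfl⟩ := Prod.mk.inj (eq_of_heq h2)
      rw [← hz', hf', add_sub_cancel_right]

/-- The part of a path space that is cut out by a condition invariant under the action. -/
def restrict (F : G.PathSpace) (p : ∀ a, F.fiber a → Prop)
    (hp : ∀ {a b : Λ} (f : a ⟶ b) (x : F.fiber a), p b (F.act f x) ↔ p a x) : G.PathSpace where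
  fiber a := {x : F.fiber a // p a x}
  act f x := ⟨F.act f x.1, (hp f x.1).2 x.2⟩
  act_comp g f x := Subtype.ext (F.act_comp g f x.1)
  existsUnique_act {b} x n := by
    obtain ⟨⟨a, f, y⟩, ⟨hf, hy⟩, hu⟩ := F.existsUnique_act x.1 n
    dsimp only at *
    refine ⟨⟨a, f, y, (hp f y).1 (hy ▸ x.2)⟩, ⟨hf, Subtype.ext hy⟩, ?_⟩
    rintro ⟨a', f', y', hy'⟩ ⟨hf', hx'⟩
    have := hu ⟨a', f', y'⟩ ⟨hf', congrArg Subtype.val hx'⟩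
    obtain ⟨rfl, h2⟩ := Sigma.mk.inj this
    obtain ⟨rfl, rfl⟩ := Prod.mk.inj (eq_of_heq h2)
    rfl

variable (F : G.PathSpace)

/-- The elements of a path space. -/
abbrev Point := Σ a : Λ, F.fiber a

theorem act_injective {a b : Λ} {f : a ⟶ b} {y y' : F.fiber a} (h : F.act f y = F.act f y') :
    y = y' := by
  have := (F.existsUnique_act (F.act f y') (G.deg f)).unique (y₁ := ⟨a, f, y⟩)
    (y₂ := ⟨a, f, y'⟩) ⟨rfl, h⟩ ⟨rfl, rfl⟩
  simpa using this

/-- `lx = y` -/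
def PathRel (l : CatPath Λ) (x y : F.Point) : Prop :=
  ∃ z : F.fiber l.src, x = ⟨l.src, z⟩ ∧ y = ⟨l.tgt, F.act l.hom z⟩

/-- The partial map by which a generator acts. -/
def GenRel : G.Gen → F.Point → F.Point → Prop
  | .vertex a, x, y => x.1 = a ∧ y = x
  | .path l, x, y => F.PathRel l.1 x y
  | .ghost l, x, y => F.PathRel l.1 y x

variable {F}

theorem PathRel.unique {l : CatPath Λ} {x y y' : F.Point} (h : F.PathRel l x y)
    (h' : F.PathRel l x y') : y = y' := by
  obtain ⟨z, rfl, rfl⟩ := h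
  obtain ⟨z', h, rfl⟩ := h'
  obtain rfl : z = z' := by simpa using h
  rfl

theorem PathRel.unique_left {l : CatPath Λ} {x x' y : F.Point} (h : F.PathRel l x y)
    (h' : F.PathRel l x' y) : x = x' := by
  obtain ⟨z, rfl, rfl⟩ := h
  obtain ⟨z', rfl, h⟩ := h'
  simp only [Sigma.mk.injEq, heq_eq_eq, true_and] at h
  rw [F.act_injective h]

/-- Both paths are the first factor of `y` in the same degree. This is the source of the
orthogonality in (KP3) and (KP4). -/
theorem PathRel.eq_of_deg_eq {l m : CatPath Λ} {x x' y : F.Point} (h : F.PathRel l x y)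
    (h' : F.PathRel m x' y) (hd : G.deg l.hom = G.deg m.hom) : l = m := by
  obtain ⟨z, rfl, rfl⟩ := h
  obtain ⟨z', rfl, h⟩ := h'
  obtain ⟨s, t, l⟩ := l
  obtain ⟨s', t', m⟩ := m
  dsimp only at *
  obtain ⟨rfl, h⟩ := Sigma.mk.inj h
  have := (F.existsUnique_act (F.act m z') (G.deg m)).unique (y₁ := ⟨s, l, z⟩)
    (y₂ := ⟨s', m, z'⟩) ⟨hd, eq_of_heq h⟩ ⟨rfl, rfl⟩
  obtain ⟨rfl, h2⟩ := Sigma.mk.inj this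
  obtain ⟨rfl, -⟩ := Prod.mk.inj (eq_of_heq h2)
  rfl

theorem exists_pathRel (x : F.Point) (n : Fin k → ℕ) :
    ∃ l : CatPath Λ, l.tgt = x.1 ∧ G.deg l.hom = n ∧ ∃ y, F.PathRel l y x := by
  obtain ⟨b, x⟩ := x
  obtain ⟨⟨a, f, y⟩, ⟨hf, hy⟩, -⟩ := F.existsUnique_act x n
  exact ⟨⟨a, b, f⟩, rfl, hf, ⟨a, y⟩, y, rfl, by rw [hy]⟩

theorem pathRel_comp {a b c : Λ} (g : a ⟶ b) (f : b ⟶ c) (x y : F.Point) :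
    F.PathRel ⟨a, c, g ≫ f⟩ x y ↔ ∃ z, F.PathRel ⟨a, b, g⟩ x z ∧ F.PathRel ⟨b, c, f⟩ z y := by
  constructor
  · rintro ⟨z, rfl, rfl⟩
    exact ⟨_, ⟨z, rfl, rfl⟩, F.act g z, rfl, by rw [F.act_comp]⟩
  · rintro ⟨_, ⟨z, rfl, rfl⟩, ⟨z', h, rfl⟩⟩
    obtain rfl : F.act g z = z' := by simpa using h
    exact ⟨z, rfl, by rw [F.act_comp]⟩

theorem GenRel.unique {g : G.Gen} {x y y' : F.Point} (h : F.GenRel g x y)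
    (h' : F.GenRel g x y') : y = y' := by
  cases g with
  | vertex a => exact h.2.trans h'.2.symm
  | path l => exact PathRel.unique h h'
  | ghost l => exact PathRel.unique_left h h'

variable (F) (R : Type*) [CommRing R]

open Classical in
/-- The operator by which a generator acts on the free module on a path space. -/
noncomputable def op (g : G.Gen) : Module.End R (F.Point →₀ R) :=
  Finsupp.linearCombination R fun x =>
    if h : ∃ y, F.GenRel g x y then Finsupp.single h.choose 1 else 0

variable {F R}

theorem op_single_of_rel {g : G.Gen} {x y : F.Point} (h : F.GenRel g x y) :
    F.op R g (Finsupp.single x 1) = Finsupp.single y 1 := by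
  have hex : ∃ y, F.GenRel g x y := ⟨y, h⟩
  rw [op, Finsupp.linearCombination_single, one_smul, dif_pos hex, hex.choose_spec.unique h]

theorem op_single_of_not {g : G.Gen} {x : F.Point} (h : ∀ y, ¬ F.GenRel g x y) :
    F.op R g (Finsupp.single x 1) = 0 := by
  rw [op, Finsupp.linearCombination_single, one_smul, dif_neg (not_exists.2 h)]

theorem op_vertex_single {a : Λ} {x : F.Point} (h : x.1 = a) :
    F.op R (.vertex a) (Finsupp.single x 1) = Finsupp.single x 1 :=
  op_single_of_rel (g := .vertex a) ⟨h, rfl⟩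

theorem op_vertex_single_of_ne {a : Λ} {x : F.Point} (h : x.1 ≠ a) :
    F.op R (.vertex a) (Finsupp.single x 1) = 0 :=
  op_single_of_not (g := .vertex a) fun _ h' => h h'.1

theorem op_path_single {l : G.NonzeroPath} {x y : F.Point} (h : F.PathRel l.1 x y) :
    F.op R (.path l) (Finsupp.single x 1) = Finsupp.single y 1 :=
  op_single_of_rel (g := .path l) h

theorem op_ghost_single {l : G.NonzeroPath} {x y : F.Point} (h : F.PathRel l.1 x y) :
    F.op R (.ghost l) (Finsupp.single y 1) = Finsupp.single x 1 :=
  op_single_of_rel (g := .ghost l) h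

theorem op_ghost_single_of_not {l : G.NonzeroPath} {y : F.Point}
    (h : ∀ x, ¬ F.PathRel l.1 x y) : F.op R (.ghost l) (Finsupp.single y 1) = 0 :=
  op_single_of_not (g := .ghost l) h

theorem end_ext {S T : Module.End R (F.Point →₀ R)}
    (h : ∀ x, S (Finsupp.single x 1) = T (Finsupp.single x 1)) : S = T :=
  Finsupp.lhom_ext' fun x => LinearMap.ext_ring (h x)

/-- Products of generators act by the composite relations. -/
theorem op_mul_single {g h : G.Gen} {x : F.Point} :
    (∃ y z, F.GenRel h x y ∧ F.GenRel g y z ∧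
      (F.op R g * F.op R h) (Finsupp.single x 1) = Finsupp.single z 1) ∨
    ((∀ y z, F.GenRel h x y → ¬ F.GenRel g y z) ∧
      (F.op R g * F.op R h) (Finsupp.single x 1) = 0) := by
  rw [Module.End.mul_apply]
  by_cases hy : ∃ y, F.GenRel h x y
  · obtain ⟨y, hy⟩ := hy
    rw [op_single_of_rel hy]
    by_cases hz : ∃ z, F.GenRel g y z
    · obtain ⟨z, hz⟩ := hz
      exact .inl ⟨y, z, hy, hz, op_single_of_rel hz⟩
    · refine .inr ⟨fun y' z hy' hz' => hz ⟨z, ?_⟩, op_single_of_not (not_exists.1 hz)⟩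
      rwa [hy.unique hy']
  · refine .inr ⟨fun y z h' _ => hy ⟨y, h'⟩, ?_⟩
    rw [op_single_of_not (not_exists.1 hy), map_zero]

/-- Reduces identities between operators to identities between partial maps. -/
theorem op_mul_eq_op {g h i : G.Gen}
    (H : ∀ x z, F.GenRel i x z ↔ ∃ y, F.GenRel h x y ∧ F.GenRel g y z) :
    F.op R g * F.op R h = F.op R i := by
  refine end_ext fun x => ?_
  rcases op_mul_single (R := R) (g := g) (h := h) (x := x) with ⟨y, z, hy, hz, e⟩ | ⟨hn, e⟩
  · rw [e, op_single_of_rel ((H x z).2 ⟨y, hy, hz⟩)]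
  · rw [e, op_single_of_not fun z hz => ?_]
    obtain ⟨y, hy, hz⟩ := (H x z).1 hz
    exact hn y z hy hz

theorem op_mul_eq_zero {g h : G.Gen}
    (H : ∀ x y z, F.GenRel h x y → ¬ F.GenRel g y z) : F.op R g * F.op R h = 0 := by
  refine end_ext fun x => ?_
  rcases op_mul_single (R := R) (g := g) (h := h) (x := x) with ⟨y, z, hy, hz, e⟩ | ⟨hn, e⟩
  · exact absurd hz (H x y z hy)
  · exact e

variable (F R)

/-- The action of the free algebra. -/
noncomputable def freeRep : G.FreeAlg R →ₙₐ[R] Module.End R (F.Point →₀ R) :=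
  MonoidAlgebra.liftMagma R (FreeSemigroup.lift (F.op R))

theorem freeRep_gen (g : G.Gen) : F.freeRep R (G.gen R g) = F.op R g := by
  rw [freeRep, gen, MonoidAlgebra.liftMagma_apply_apply]
  simp

-- (KP1)–(KP3) are statements about composites of partial maps. In (KP4), a basis point with range
-- `a` has exactly one first factor of degree `n`, so exactly one summand fixes it and the others
-- kill it.
variable {R} in
theorem freeRep_rel (hG : G.RowFinite) {x y : G.FreeAlg R} (h : KPRel hG R x y) :
    F.freeRep R x = F.freeRep R y := by
  induction h with
  | vertex_idem a =>
    rw [map_mul, freeRep_gen]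
    refine op_mul_eq_op fun x z => ⟨fun h => ⟨x, ⟨h.1, rfl⟩, h⟩, ?_⟩
    rintro ⟨y, ⟨h1, rfl⟩, h⟩
    exact h
  | vertex_orth a b h =>
    rw [map_mul, freeRep_gen, freeRep_gen, map_zero]
    refine op_mul_eq_zero ?_
    rintro x y z ⟨h1, rfl⟩ ⟨h2, -⟩
    exact h (h2.symm.trans h1)
  | path_mul f g hf hg hfg =>
    rw [map_mul, freeRep_gen, freeRep_gen, freeRep_gen]
    exact op_mul_eq_op fun x z => pathRel_comp g f x z
  | ghost_mul f g hf hg hfg =>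
    rw [map_mul, freeRep_gen, freeRep_gen, freeRep_gen]
    exact op_mul_eq_op fun x z => (pathRel_comp g f z x).trans (by simp only [and_comm]; rfl)
  | range_path l =>
    rw [map_mul, freeRep_gen, freeRep_gen]
    refine op_mul_eq_op fun x z => ⟨fun h => ⟨z, h, ?_, rfl⟩, ?_⟩
    · obtain ⟨t, -, rfl⟩ := h
      rfl
    · rintro ⟨y, h, -, rfl⟩
      exact h
  | path_source l =>
    rw [map_mul, freeRep_gen, freeRep_gen]
    refine op_mul_eq_op fun x z => ⟨fun h => ⟨x, ⟨?_, rfl⟩, h⟩, ?_⟩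
    · obtain ⟨t, rfl, -⟩ := h
      rfl
    · rintro ⟨y, ⟨-, rfl⟩, h⟩
      exact h
  | source_ghost l =>
    rw [map_mul, freeRep_gen, freeRep_gen]
    refine op_mul_eq_op fun x z => ⟨fun h => ⟨z, h, ?_, rfl⟩, ?_⟩
    · obtain ⟨t, rfl, -⟩ := h
      rfl
    · rintro ⟨y, h, -, rfl⟩
      exact h
  | ghost_range l =>
    rw [map_mul, freeRep_gen, freeRep_gen]
    refine op_mul_eq_op fun x z => ⟨fun h => ⟨x, ⟨?_, rfl⟩, h⟩, ?_⟩
    · obtain ⟨t, -, rfl⟩ := h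
      rfl
    · rintro ⟨y, ⟨-, rfl⟩, h⟩
      exact h
  | ghost_path_self l =>
    rw [map_mul, freeRep_gen, freeRep_gen, freeRep_gen]
    refine op_mul_eq_op fun x z => ⟨?_, ?_⟩
    · rintro ⟨h, rfl⟩
      obtain ⟨a, z⟩ := z
      subst h
      exact ⟨_, ⟨z, rfl, rfl⟩, z, rfl, rfl⟩
    · rintro ⟨y, h, h'⟩
      obtain rfl := PathRel.unique_left h h'
      obtain ⟨t, rfl, -⟩ := h
      exact ⟨rfl, rfl⟩
  | ghost_path_ne l m hd h =>
    rw [map_mul, freeRep_gen, freeRep_gen, map_zero]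
    exact op_mul_eq_zero fun x y z h1 h2 => h (Subtype.ext (PathRel.eq_of_deg_eq h2 h1 hd))
  | vertex_sum a n hn =>
    rw [map_sum]
    simp only [map_mul, freeRep_gen]
    refine end_ext fun x => ?_
    rw [LinearMap.sum_apply]
    obtain ⟨l, hl, hd, y, hy⟩ := exists_pathRel x n
    by_cases hx : x.1 = a
    · subst hx
      rw [op_vertex_single rfl, Finset.sum_eq_single ⟨l, by rwa [hd]⟩]
      · rw [Module.End.mul_apply, op_ghost_single hy, op_path_single hy]
      · intro m hm hne
        rw [Set.Finite.mem_toFinset] at hm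
        rw [Module.End.mul_apply, op_ghost_single_of_not, map_zero]
        intro y' hy'
        exact hne (Subtype.ext (PathRel.eq_of_deg_eq hy' hy (hm.2.trans hd.symm)))
      · intro h
        exact (h (by rw [Set.Finite.mem_toFinset]; exact ⟨hl, hd⟩)).elim
    · rw [op_vertex_single_of_ne hx, Finset.sum_eq_zero]
      intro m hm
      rw [Set.Finite.mem_toFinset] at hm
      rw [Module.End.mul_apply, op_ghost_single_of_not, map_zero]
      rintro y' ⟨t, -, rfl⟩
      exact hx hm.1

/-- The ideal of elements of the free algebra that act as zero contains the Kumjian-Pask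
relators. -/
theorem kpIdeal_le_ker (hG : G.RowFinite) :
    kpIdeal hG R ≤ TwoSidedIdeal.ker (F.freeRep R) := by
  rw [kpIdeal, TwoSidedIdeal.span_le]
  rintro _ ⟨t, x, y, h, rfl⟩
  rw [SetLike.mem_coe, TwoSidedIdeal.mem_ker, map_smul, map_sub, F.freeRep_rel hG h, sub_self,
    smul_zero]

/-- The representation of the Kumjian-Pask algebra on the free module on a path space. -/
noncomputable def rep (hG : G.RowFinite) : KP hG R →ₙ+* Module.End R (F.Point →₀ R) where
  toFun := Quotient.lift (F.freeRep R) fun x y h => by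
    have h1 : x - y ∈ kpIdeal hG R := (TwoSidedIdeal.rel_iff _ _ _).1 h
    have h2 := F.kpIdeal_le_ker R hG h1
    rwa [TwoSidedIdeal.mem_ker, map_sub, sub_eq_zero] at h2
  map_mul' x y := by
    obtain ⟨x, rfl⟩ := KP.mk_surjective hG R x
    obtain ⟨y, rfl⟩ := KP.mk_surjective hG R y
    exact map_mul (F.freeRep R) x y
  map_zero' := map_zero (F.freeRep R)
  map_add' x y := by
    obtain ⟨x, rfl⟩ := KP.mk_surjective hG R x
    obtain ⟨y, rfl⟩ := KP.mk_surjective hG R y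
    exact map_add (F.freeRep R) x y

theorem rep_mk (hG : G.RowFinite) (x : G.FreeAlg R) :
    F.rep R hG (KP.mk hG R x) = F.freeRep R x := rfl

theorem rep_smul (hG : G.RowFinite) (t : R) (x : KP hG R) :
    F.rep R hG (t • x) = t • F.rep R hG x := by
  obtain ⟨x, rfl⟩ := KP.mk_surjective hG R x
  exact map_smul (F.freeRep R) t x

end PathSpace

end Representations

end KGraph

/-! ### Calculus in the Kumjian–Pask algebra. -/

namespace KGraph

namespace KP

section Algebra

variable {k : ℕ} {Λ : Type u} [Category.{v} Λ] {G : KGraph k Λ} (hG : G.RowFinite)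
  (R : Type w) [CommRing R]

theorem mk_mul (x y : G.FreeAlg R) : mk hG R (x * y) = mk hG R x * mk hG R y := rfl

theorem mk_smul (t : R) (x : G.FreeAlg R) : mk hG R (t • x) = t • mk hG R x := rfl

theorem mk_sum {ι : Type*} (s : Finset ι) (f : ι → G.FreeAlg R) :
    mk hG R (∑ i ∈ s, f i) = ∑ i ∈ s, mk hG R (f i) :=
  map_sum (⟨⟨mk hG R, rfl⟩, fun _ _ => rfl⟩ : G.FreeAlg R →+ KP hG R) f s

variable {R} in
theorem mk_eq {x y : G.FreeAlg R} (h : KPRel hG R x y) : mk hG R x = mk hG R y := by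
  refine Quotient.sound ?_
  change (kpIdeal hG R).ringCon x y
  rw [TwoSidedIdeal.rel_iff]
  exact TwoSidedIdeal.subset_span ⟨1, x, y, h, (one_smul _ _).symm⟩

/-- The vertex idempotent `p_a`. -/
noncomputable def p (a : Λ) : KP hG R := mk hG R (G.gen R (.vertex a))

open Classical in
/-- The element `s_f`, which is `p_{r(f)}` if `f` has degree `0`. -/
noncomputable def s {a b : Λ} (f : a ⟶ b) : KP hG R :=
  if hf : G.deg f = 0 then p hG R b else mk hG R (G.gen R (.path ⟨⟨a, b, f⟩, hf⟩))

open Classical in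
/-- The element `s_{f*}`, which is `p_{r(f)}` if `f` has degree `0`. -/
noncomputable def sStar {a b : Λ} (f : a ⟶ b) : KP hG R :=
  if hf : G.deg f = 0 then p hG R b else mk hG R (G.gen R (.ghost ⟨⟨a, b, f⟩, hf⟩))

variable {R}

theorem s_of_ne {a b : Λ} {f : a ⟶ b} (hf : G.deg f ≠ 0) :
    s hG R f = mk hG R (G.gen R (.path ⟨⟨a, b, f⟩, hf⟩)) := dif_neg hf

theorem sStar_of_ne {a b : Λ} {f : a ⟶ b} (hf : G.deg f ≠ 0) :
    sStar hG R f = mk hG R (G.gen R (.ghost ⟨⟨a, b, f⟩, hf⟩)) := dif_neg hf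

@[simp]
theorem s_id (a : Λ) : s hG R (𝟙 a) = p hG R a := dif_pos (G.deg_id a)

@[simp]
theorem sStar_id (a : Λ) : sStar hG R (𝟙 a) = p hG R a := dif_pos (G.deg_id a)

@[simp]
theorem p_mul_self (a : Λ) : p hG R a * p hG R a = p hG R a := mk_eq hG (.vertex_idem a)

theorem p_mul_of_ne {a b : Λ} (h : a ≠ b) : p hG R a * p hG R b = 0 :=
  mk_eq hG (.vertex_orth a b h)

@[simp]
theorem p_mul_s {a b : Λ} (f : a ⟶ b) : p hG R b * s hG R f = s hG R f := by
  by_cases hf : G.deg f = 0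
  · exact G.eq_id_of_deg_eq_zero (motive := fun {a} f => p hG R b * s hG R f = s hG R f)
      (by simp) f hf
  · rw [s_of_ne hG hf]
    exact mk_eq hG (.range_path ⟨⟨a, b, f⟩, hf⟩)

@[simp]
theorem s_mul_p {a b : Λ} (f : a ⟶ b) : s hG R f * p hG R a = s hG R f := by
  by_cases hf : G.deg f = 0
  · exact G.eq_id_of_deg_eq_zero (motive := fun {a} f => s hG R f * p hG R a = s hG R f)
      (by simp) f hf
  · rw [s_of_ne hG hf]
    exact mk_eq hG (.path_source ⟨⟨a, b, f⟩, hf⟩)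

@[simp]
theorem p_mul_sStar {a b : Λ} (f : a ⟶ b) : p hG R a * sStar hG R f = sStar hG R f := by
  by_cases hf : G.deg f = 0
  · exact G.eq_id_of_deg_eq_zero (motive := fun {a} f => p hG R a * sStar hG R f = sStar hG R f)
      (by simp) f hf
  · rw [sStar_of_ne hG hf]
    exact mk_eq hG (.source_ghost ⟨⟨a, b, f⟩, hf⟩)

@[simp]
theorem sStar_mul_p {a b : Λ} (f : a ⟶ b) : sStar hG R f * p hG R b = sStar hG R f := by
  by_cases hf : G.deg f = 0
  · exact G.eq_id_of_deg_eq_zero (motive := fun {a} f => sStar hG R f * p hG R b = sStar hG R f)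
      (by simp) f hf
  · rw [sStar_of_ne hG hf]
    exact mk_eq hG (.ghost_range ⟨⟨a, b, f⟩, hf⟩)

theorem s_mul_s {a b c : Λ} (f : b ⟶ c) (g : a ⟶ b) : s hG R f * s hG R g = s hG R (g ≫ f) := by
  by_cases hf : G.deg f = 0
  · revert g
    exact G.eq_id_of_deg_eq_zero
      (motive := fun {b} f => ∀ g : a ⟶ b, s hG R f * s hG R g = s hG R (g ≫ f)) (by simp) f hf
  by_cases hg : G.deg g = 0
  · exact G.eq_id_of_deg_eq_zero
      (motive := fun {a} g => s hG R f * s hG R g = s hG R (g ≫ f)) (by simp) g hg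
  have hfg : G.deg (g ≫ f) ≠ 0 := by
    rw [G.deg_comp]
    exact fun h => hg (add_eq_zero.1 h).1
  rw [s_of_ne hG hf, s_of_ne hG hg, s_of_ne hG hfg]
  exact mk_eq hG (.path_mul f g hf hg hfg)

theorem sStar_mul_sStar {a b c : Λ} (f : b ⟶ c) (g : a ⟶ b) :
    sStar hG R g * sStar hG R f = sStar hG R (g ≫ f) := by
  by_cases hf : G.deg f = 0
  · revert g
    exact G.eq_id_of_deg_eq_zero
      (motive := fun {b} f => ∀ g : a ⟶ b, sStar hG R g * sStar hG R f = sStar hG R (g ≫ f))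
      (by simp) f hf
  by_cases hg : G.deg g = 0
  · exact G.eq_id_of_deg_eq_zero
      (motive := fun {a} g => sStar hG R g * sStar hG R f = sStar hG R (g ≫ f)) (by simp) g hg
  have hfg : G.deg (g ≫ f) ≠ 0 := by
    rw [G.deg_comp]
    exact fun h => hg (add_eq_zero.1 h).1
  rw [sStar_of_ne hG hf, sStar_of_ne hG hg, sStar_of_ne hG hfg]
  exact mk_eq hG (.ghost_mul f g hf hg hfg)

@[simp]
theorem sStar_mul_s_self {a b : Λ} (f : a ⟶ b) : sStar hG R f * s hG R f = p hG R a := by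
  by_cases hf : G.deg f = 0
  · exact G.eq_id_of_deg_eq_zero (motive := fun {a} f => sStar hG R f * s hG R f = p hG R a)
      (by simp) f hf
  · rw [sStar_of_ne hG hf, s_of_ne hG hf]
    exact mk_eq hG (.ghost_path_self ⟨⟨a, b, f⟩, hf⟩)

theorem sStar_mul_s_of_ne {a b c d : Λ} {f : a ⟶ b} {g : c ⟶ d} (hd : G.deg f = G.deg g)
    (h : (⟨a, b, f⟩ : CatPath Λ) ≠ ⟨c, d, g⟩) : sStar hG R f * s hG R g = 0 := by
  by_cases hf : G.deg f = 0
  · have hg : G.deg g = 0 := hd ▸ hf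
    rw [sStar, dif_pos hf, s, dif_pos hg]
    refine p_mul_of_ne hG ?_
    rintro rfl
    refine h (G.eq_id_of_deg_eq_zero (motive := fun {a} f => (⟨a, b, f⟩ : CatPath Λ) = ⟨c, b, g⟩)
      ?_ f hf)
    exact G.eq_id_of_deg_eq_zero (motive := fun {c} g => (⟨b, b, 𝟙 b⟩ : CatPath Λ) = ⟨c, b, g⟩)
      rfl g hg
  · have hg : G.deg g ≠ 0 := hd ▸ hf
    rw [sStar_of_ne hG hf, s_of_ne hG hg]
    exact mk_eq hG (.ghost_path_ne ⟨⟨a, b, f⟩, hf⟩ ⟨⟨c, d, g⟩, hg⟩ hd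
      fun e => h (congrArg Subtype.val e))

/-- Includes `n = 0`, where the identity is the only path, so that later expansions need no case
distinction. -/
theorem p_eq_sum (a : Λ) (n : Fin k → ℕ) :
    p hG R a = ∑ l ∈ (hG a n).toFinset, s hG R l.hom * sStar hG R l.hom := by
  by_cases hn : n = 0
  · subst hn
    have : (hG a 0).toFinset = {⟨a, a, 𝟙 a⟩} := by
      ext l
      rw [Set.Finite.mem_toFinset, Finset.mem_singleton]
      constructor
      · rintro ⟨rfl, h⟩
        obtain ⟨b, a, l⟩ := l
        exact G.eq_id_of_deg_eq_zero
          (motive := fun {b} l => (⟨b, a, l⟩ : CatPath Λ) = ⟨a, a, 𝟙 a⟩) rfl l h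
      · rintro rfl
        exact ⟨rfl, G.deg_id a⟩
    rw [this, Finset.sum_singleton, s_id, sStar_id, p_mul_self]
  · have : (hG a n).toFinset =
        (hG.finite_nonzero a n).toFinset.map (Function.Embedding.subtype _) := by
      ext l
      simp only [Set.Finite.mem_toFinset, Finset.mem_map, Set.mem_ofPred_eq]
      constructor
      · intro h
        exact ⟨⟨l, by rw [h.2]; exact hn⟩, h, rfl⟩
      · rintro ⟨m, hm, rfl⟩
        exact hm
    rw [this, Finset.sum_map, p, mk_eq hG (.vertex_sum a n hn), mk_sum]
    refine Finset.sum_congr rfl fun l _ => ?_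
    rw [mk_mul]
    exact congrArg₂ _ (s_of_ne hG l.2).symm (sStar_of_ne hG l.2).symm

/-- To show that `x p_a y` belongs to a submodule, expand `p_a` in some degree. -/
theorem mul_p_mul_mem {V : Submodule R (KP hG R)} {a : Λ} (n : Fin k → ℕ) {x y : KP hG R}
    (H : ∀ (b : Λ) (l : b ⟶ a), G.deg l = n → x * s hG R l * (sStar hG R l * y) ∈ V) :
    x * p hG R a * y ∈ V := by
  rw [p_eq_sum hG a n, Finset.mul_sum, Finset.sum_mul]
  refine V.sum_mem fun l hl => ?_
  rw [Set.Finite.mem_toFinset] at hl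
  obtain ⟨b, a', l⟩ := l
  obtain ⟨rfl, h⟩ := hl
  have := H b l h
  simpa only [mul_assoc] using this

/-- Expand the vertex at the source of `g` in degree `deg f`. Each `gl` begins with a path of degree
`deg f`; it is not `f`, since `gl` would then extend both, so (KP3) kills the term. -/
theorem sStar_mul_s_eq_zero {a b c d : Λ} {f : a ⟶ b} {g : c ⟶ d}
    (H : ∀ (e : Λ) (p : e ⟶ a) (q : e ⟶ c),
      (⟨e, b, p ≫ f⟩ : CatPath Λ) ≠ ⟨e, d, q ≫ g⟩) : sStar hG R f * s hG R g = 0 := by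
  -- The second `p_c` only supplies the right-hand factor that the expansion lemma expects.
  have : sStar hG R f * s hG R g * p hG R c * p hG R c ∈ (⊥ : Submodule R (KP hG R)) := by
    refine mul_p_mul_mem hG (G.deg f) fun e l hl => ?_
    obtain ⟨b', x, h, hx, -, hxl⟩ := G.exists_fac (l ≫ g) (m := G.deg f)
      (by rw [G.deg_comp, hl]; exact le_self_add)
    rw [Submodule.mem_bot, mul_assoc (sStar hG R f), s_mul_s, ← hxl, ← s_mul_s,
      ← mul_assoc (sStar hG R f) (s hG R x), sStar_mul_s_of_ne hG hx.symm]
    · simp only [zero_mul]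
    intro e'
    simp only [CatPath.mk.injEq] at e'
    obtain ⟨rfl, rfl, e'⟩ := e'
    exact H e h l (by rw [eq_of_heq e', hxl])
  rwa [mul_assoc, p_mul_self, mul_assoc, s_mul_p, Submodule.mem_bot] at this

/-! ### Spanning by the elements `s_f s_{g*}` with `g` of fixed degree. -/

variable (G) in
/-- A pair of paths with the same source. -/
structure CommonSource where
  /-- the common source -/
  src : Λ
  /-- the range of the first path -/
  left : Λ
  /-- the range of the second path -/
  right : Λ
  /-- the first path -/
  fst : src ⟶ left
  /-- the second path -/
  snd : src ⟶ right

variable (R) in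
/-- The span of the elements `s_f s_{g*}` with `d(g) = n`. -/
noncomputable def level (n : Fin k → ℕ) : Submodule R (KP hG R) :=
  Submodule.span R (Set.range fun i : {i : CommonSource (Λ := Λ) // G.deg i.snd = n} =>
    s hG R i.1.fst * sStar hG R i.1.snd)

theorem mul_mem_level {a b c : Λ} (f : a ⟶ b) (g : a ⟶ c) {n : Fin k → ℕ} (hg : G.deg g = n) :
    s hG R f * sStar hG R g ∈ level hG R n :=
  Submodule.subset_span ⟨⟨⟨a, b, c, f, g⟩, hg⟩, rfl⟩

theorem level_le {n : Fin k → ℕ} {x : KP hG R} {V : Submodule R (KP hG R)}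
    (H : ∀ {a b c : Λ} (f : a ⟶ b) (g : a ⟶ c), G.deg g = n →
      x * (s hG R f * sStar hG R g) ∈ V) {y : KP hG R} (hy : y ∈ level hG R n) : x * y ∈ V := by
  have : level hG R n ≤ V.comap (LinearMap.mulLeft R x) := by
    rw [level, Submodule.span_le]
    rintro _ ⟨i, rfl⟩
    exact H i.1.fst i.1.snd i.2
  exact this hy

/-- Expanding the vertex between `s_f` and `s_{g*}` in degree `m - n` lengthens both paths. -/
theorem level_mono {n m : Fin k → ℕ} (h : n ≤ m) : level hG R n ≤ level hG R m := by
  rw [level, Submodule.span_le]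
  rintro _ ⟨⟨⟨a, b, c, f, g⟩, hi⟩, rfl⟩
  dsimp only at hi ⊢
  have : s hG R f * p hG R a * sStar hG R g ∈ level hG R m := by
    refine mul_p_mul_mem hG (m - n) fun d l hl => ?_
    rw [s_mul_s, sStar_mul_sStar]
    exact mul_mem_level hG _ _ (by rw [G.deg_comp, hl, hi, tsub_add_cancel_of_le h])
  rwa [s_mul_p] at this

/-- Vertices and paths preserve the level. For a ghost path `h*`, expanding in degree `deg h` makes
every `fl` long enough to begin with a path of degree `deg h`, and (KP3) then either removes `h` or
gives zero. -/
theorem exists_mul_mem_level (g : G.Gen) (n : Fin k → ℕ) :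
    ∃ m, ∀ y ∈ level hG R n, mk hG R (G.gen R g) * y ∈ level hG R m := by
  cases g with
  | vertex b' =>
    refine ⟨n, fun y hy => level_le hG (fun {a b c} f g hg => ?_) hy⟩
    change p hG R b' * _ ∈ _
    by_cases hb : b' = b
    · rw [hb, ← mul_assoc, p_mul_s]
      exact mul_mem_level hG f g hg
    · rw [← p_mul_s hG f, mul_assoc, ← mul_assoc, p_mul_of_ne hG hb, zero_mul]
      exact Submodule.zero_mem _
  | path l =>
    obtain ⟨⟨c', d, h⟩, hh⟩ := l
    refine ⟨n, fun y hy => level_le hG (fun {a b c} f g hg => ?_) hy⟩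
    rw [← s_of_ne hG hh]
    by_cases hb : c' = b
    · subst hb
      rw [← mul_assoc, s_mul_s]
      exact mul_mem_level hG _ g hg
    · rw [← p_mul_s hG f, ← s_mul_p hG h, mul_assoc, mul_assoc, ← mul_assoc (p hG R c'),
        p_mul_of_ne hG hb, zero_mul, mul_zero]
      exact Submodule.zero_mem _
  | ghost l =>
    obtain ⟨⟨c', d, h⟩, hh⟩ := l
    refine ⟨G.deg h + n, fun y hy => level_le hG (fun {a b c} f g hg => ?_) hy⟩
    rw [← sStar_of_ne hG hh]
    have : sStar hG R h * s hG R f * p hG R a * sStar hG R g ∈ level hG R (G.deg h + n) := by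
      refine mul_p_mul_mem hG (G.deg h) fun e l hl => ?_
      obtain ⟨b', x, r, hx, -, hxl⟩ := G.exists_fac (l ≫ f) (m := G.deg h)
        (by rw [G.deg_comp, hl]; exact le_self_add)
      rw [mul_assoc (sStar hG R h), s_mul_s, sStar_mul_sStar, ← hxl, ← s_mul_s, ← mul_assoc]
      by_cases e' : (⟨c', d, h⟩ : CatPath Λ) = ⟨b', b, x⟩
      · simp only [CatPath.mk.injEq] at e'
        obtain ⟨rfl, rfl, e'⟩ := e'
        rw [← eq_of_heq e', sStar_mul_s_self, p_mul_s]
        exact mul_mem_level hG _ _ (by rw [G.deg_comp, hl, hg])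
      · rw [sStar_mul_s_of_ne hG hx.symm e', zero_mul, zero_mul]
        exact Submodule.zero_mem _
    rwa [mul_assoc _ (s hG R f), s_mul_p, mul_assoc] at this

theorem exists_gen_mem_level (g : G.Gen) : ∃ m, mk hG R (G.gen R g) ∈ level hG R m := by
  cases g with
  | vertex a =>
    refine ⟨0, ?_⟩
    have := mul_mem_level hG (R := R) (𝟙 a) (𝟙 a) (G.deg_id a)
    rwa [s_id, sStar_id, p_mul_self] at this
  | path l =>
    obtain ⟨⟨a, b, f⟩, hf⟩ := l
    refine ⟨0, ?_⟩
    have := mul_mem_level hG (R := R) f (𝟙 a) (G.deg_id a)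
    rwa [sStar_id, s_mul_p, s_of_ne hG hf] at this
  | ghost l =>
    obtain ⟨⟨a, b, f⟩, hf⟩ := l
    refine ⟨G.deg f, ?_⟩
    have := mul_mem_level hG (R := R) (𝟙 a) f rfl
    rwa [s_id, p_mul_sStar, sStar_of_ne hG hf] at this

/-- Words are built up by adding letters on the left; sums pass to the common level `n ⊔ m`. -/
theorem exists_mem_level (z : KP hG R) : ∃ n, z ∈ level hG R n := by
  obtain ⟨x, rfl⟩ := mk_surjective hG R z
  induction x using MonoidAlgebra.induction_linear with
  | zero => exact ⟨0, Submodule.zero_mem _⟩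
  | add x y hx hy =>
    obtain ⟨n, hn⟩ := hx
    obtain ⟨m, hm⟩ := hy
    exact ⟨n ⊔ m, Submodule.add_mem _ (level_mono hG le_sup_left hn)
      (level_mono hG le_sup_right hm)⟩
  | single w r =>
    suffices ∃ n, mk hG R (MonoidAlgebra.single w 1) ∈ level hG R n by
      obtain ⟨n, hn⟩ := this
      refine ⟨n, ?_⟩
      have := Submodule.smul_mem _ r hn
      rwa [← mk_smul, MonoidAlgebra.smul_single, smul_eq_mul, mul_one] at this
    induction w using FreeSemigroup.recOnMul with
    | ih1 g => exact exists_gen_mem_level hG g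
    | ih2 g w _ ih =>
      obtain ⟨n, hn⟩ := ih
      obtain ⟨m, hm⟩ := exists_mul_mem_level hG (R := R) g n
      refine ⟨m, ?_⟩
      have := hm _ hn
      rwa [← mk_mul, gen, MonoidAlgebra.single_mul_single, one_mul] at this

/-- The algebraic Cuntz-Krieger uniqueness theorem: in the aperiodic case every nonzero ideal
contains a nonzero multiple of a vertex. -/
theorem exists_mul_mul_eq_smul_p (hA : G.Aperiodic) {z : KP hG R} (hz : z ≠ 0) :
    ∃ (x y : KP hG R) (t : R) (a : Λ), t ≠ 0 ∧ x * z * y = t • p hG R a := by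
  classical
  obtain ⟨n, hn⟩ := exists_mem_level hG z
  rw [level, Finsupp.mem_span_range_iff_exists_finsupp] at hn
  obtain ⟨c, rfl⟩ := hn
  have hc : c.support.Nonempty := by
    rw [Finset.nonempty_iff_ne_empty]
    intro h
    rw [Finsupp.support_eq_empty] at h
    exact hz (by rw [h, Finsupp.sum_zero_index])
  obtain ⟨⟨⟨a, b, b', f, g⟩, hi⟩, hic⟩ := hc
  dsimp only at hi
  -- the paths that compete with `f`
  let comp : {i : CommonSource (Λ := Λ) // G.deg i.snd = n} → Finset (Σ c : Λ, (a ⟶ c)) := fun i =>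
    if h : i.1.src = a then {⟨i.1.left, eqToHom h.symm ≫ i.1.fst⟩} else ∅
  obtain ⟨d, l, hl⟩ := hA.exists_separating_finset f ((c.support.biUnion comp).erase ⟨b, f⟩)
    (Finset.notMem_erase _ _)
  -- The scalar is the coefficient of the chosen term, since `s_{(fl)*} s_f s_{g*} s_{gl} = p_d`.
  refine ⟨sStar hG R (l ≫ f), s hG R (l ≫ g), _, d, Finsupp.mem_support_iff.1 hic, ?_⟩
  rw [Finsupp.sum, Finset.mul_sum, Finset.sum_mul, Finset.sum_eq_single_of_mem _ hic]
  · dsimp only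
    rw [mul_smul_comm, smul_mul_assoc, ← s_mul_s hG g l]
    congr 1
    rw [mul_assoc, mul_assoc, ← mul_assoc (sStar hG R g), sStar_mul_s_self, p_mul_s, s_mul_s,
      sStar_mul_s_self]
  · rintro ⟨⟨a', c', d', f', g'⟩, hj⟩ hjc hne
    dsimp only at hj ⊢
    rw [mul_smul_comm, smul_mul_assoc, ← s_mul_s hG g l]
    -- All second paths have degree `n`, so (KP3) kills the terms with `g' ≠ g`. If `g' = g`, then
    -- `f'` is a competitor of `f`, and `l` was chosen to leave `fl` and `f'l` without a common
    -- extension.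
    by_cases e : (⟨a', d', g'⟩ : CatPath Λ) = ⟨a, b', g⟩
    · simp only [CatPath.mk.injEq] at e
      obtain ⟨rfl, rfl, e⟩ := e
      obtain rfl := eq_of_heq e
      rw [mul_assoc, mul_assoc, ← mul_assoc (sStar hG R g'), sStar_mul_s_self, p_mul_s, s_mul_s,
        sStar_mul_s_eq_zero, smul_zero]
      refine hl ⟨c', f'⟩ (Finset.mem_erase.2 ⟨fun h => hne ?_, Finset.mem_biUnion.2
        ⟨_, hjc, ?_⟩⟩)
      · obtain ⟨rfl, h⟩ := Sigma.mk.inj h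
        obtain rfl := eq_of_heq h
        rfl
      · simp [comp]
    · rw [mul_assoc, mul_assoc, ← mul_assoc (sStar hG R g'),
        sStar_mul_s_of_ne hG (hj.trans hi.symm) e, zero_mul, mul_zero, mul_zero, smul_zero]

end Algebra

end KP

end KGraph

/-! ### The two implications of the theorem. -/

namespace KGraph

section Simplicity

variable {k : ℕ} {Λ : Type u} [Category.{v} Λ] {G : KGraph k Λ} (hG : G.RowFinite)
  {R : Type w} [CommRing R]

namespace PathSpace

variable (F : G.PathSpace)

/-- Not an axiom of path spaces: the identity is idempotent and acts injectively. -/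
theorem act_id {a : Λ} (x : F.fiber a) : F.act (𝟙 a) x = x :=
  F.act_injective (f := 𝟙 a) (by rw [← F.act_comp, Category.id_comp])

theorem rep_p {a : Λ} (x : F.fiber a) :
    F.rep R hG (KP.p hG R a) (Finsupp.single ⟨a, x⟩ 1) = Finsupp.single ⟨a, x⟩ 1 := by
  rw [KP.p, rep_mk, freeRep_gen]
  exact op_vertex_single rfl

theorem rep_p_of_ne {a : Λ} {x : F.Point} (h : x.1 ≠ a) :
    F.rep R hG (KP.p hG R a) (Finsupp.single x 1) = 0 := by
  rw [KP.p, rep_mk, freeRep_gen]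
  exact op_vertex_single_of_ne h

theorem rep_s {a b : Λ} (f : a ⟶ b) (x : F.fiber a) :
    F.rep R hG (KP.s hG R f) (Finsupp.single ⟨a, x⟩ 1) = Finsupp.single ⟨b, F.act f x⟩ 1 := by
  by_cases hf : G.deg f = 0
  · revert x
    refine G.eq_id_of_deg_eq_zero (motive := fun {a} f => ∀ x : F.fiber a,
      F.rep R hG (KP.s hG R f) (Finsupp.single ⟨a, x⟩ 1) = Finsupp.single ⟨b, F.act f x⟩ 1)
      (fun x => ?_) f hf
    rw [KP.s_id, rep_p, act_id]
  · rw [KP.s_of_ne hG hf, rep_mk, freeRep_gen]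
    exact op_path_single ⟨x, rfl, rfl⟩

theorem rep_sStar {a b : Λ} (f : a ⟶ b) (x : F.fiber a) :
    F.rep R hG (KP.sStar hG R f) (Finsupp.single ⟨b, F.act f x⟩ 1) = Finsupp.single ⟨a, x⟩ 1 := by
  rw [← rep_s hG, ← Module.End.mul_apply, ← map_mul, KP.sStar_mul_s_self, rep_p]

theorem rep_sStar_of_not {a b : Λ} (f : a ⟶ b) {x : F.Point}
    (h : ∀ y : F.fiber a, x ≠ ⟨b, F.act f y⟩) :
    F.rep R hG (KP.sStar hG R f) (Finsupp.single x 1) = 0 := by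
  by_cases hf : G.deg f = 0
  · revert h
    refine G.eq_id_of_deg_eq_zero (motive := fun {a} f => (∀ y : F.fiber a, x ≠ ⟨b, F.act f y⟩) →
      F.rep R hG (KP.sStar hG R f) (Finsupp.single x 1) = 0) (fun h => ?_) f hf
    rw [KP.sStar_id]
    refine F.rep_p_of_ne hG ?_
    rintro rfl
    exact h x.2 (by rw [act_id])
  · rw [KP.sStar_of_ne hG hf, rep_mk, freeRep_gen]
    refine op_ghost_single_of_not ?_
    rintro _ ⟨y, -, rfl⟩
    exact h y rfl

/-- The element `s_f s_{f*} - s_g s_{f*}` acts as zero if `f` and `g` act in the same way. -/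
theorem rep_sub_eq_zero {a b : Λ} {f g : a ⟶ b} (h : ∀ x : F.fiber a, F.act f x = F.act g x) :
    F.rep R hG (KP.s hG R f * KP.sStar hG R f - KP.s hG R g * KP.sStar hG R f) = 0 := by
  rw [map_sub, map_mul, map_mul, sub_eq_zero]
  refine end_ext fun x => ?_
  rw [Module.End.mul_apply, Module.End.mul_apply]
  by_cases hx : ∃ y : F.fiber a, x = ⟨b, F.act f y⟩
  · obtain ⟨y, rfl⟩ := hx
    rw [rep_sStar, rep_s, rep_s, h]
  · rw [rep_sStar_of_not _ _ _ fun y hy => hx ⟨y, hy⟩, map_zero, map_zero]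

/-- The element `s_f s_{f*} - s_g s_{f*}` is not zero if `f` and `g` have different degrees. -/
theorem deg_eq_of_sub_eq_zero [Nontrivial R] {a b : Λ} {f g : a ⟶ b} (x : F.fiber a)
    (h : KP.s hG R f * KP.sStar hG R f - KP.s hG R g * KP.sStar hG R f = 0) :
    G.deg f = G.deg g := by
  -- Started at `0`, the `ℤᵏ`-coordinate becomes the degree of the path applied.
  let y : F.graded.fiber a := (x, 0)
  have h1 := congrArg (fun u => F.graded.rep R hG u
    (Finsupp.single ⟨b, F.graded.act f y⟩ 1)) h
  simp only [map_sub, map_mul, map_zero, LinearMap.sub_apply, Module.End.mul_apply,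
    LinearMap.zero_apply] at h1
  rw [rep_sStar, rep_s, rep_s, sub_eq_zero] at h1
  have h2 := (Finsupp.single_left_inj one_ne_zero).1 h1
  simp only [Sigma.mk.injEq, heq_eq_eq, true_and] at h2
  funext i
  have h3 := congrFun (congrArg Prod.snd h2) i
  simpa [graded, y] using h3

end PathSpace

/-- An infinite path with range `a` is a basis vector that `t • p_a` multiplies by `t`. -/
theorem rep_infinitePaths_smul_p_ne_zero (hS : G.NoSources) {t : R} (ht : t ≠ 0) (a : Λ) :
    t • KP.p hG R a ≠ 0 := by
  obtain ⟨x⟩ := PathFamily.nonempty hS a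
  intro h
  have := congrArg (fun z => (PathSpace.infinitePaths G).rep R hG z
    (Finsupp.single ⟨a, x⟩ 1) ⟨a, x⟩) h
  simp only [PathSpace.rep_smul, map_zero, LinearMap.smul_apply, LinearMap.zero_apply] at this
  rw [PathSpace.rep_p hG (PathSpace.infinitePaths G) (x := x)] at this
  simp [ht] at this

/-! ### Necessity of the three conditions. -/

theorem KP.nontrivial_coeff [Nontrivial (KP hG R)] : Nontrivial R := by
  by_contra h
  rw [not_nontrivial_iff_subsingleton] at h
  have := Module.subsingleton R (KP hG R)
  exact not_subsingleton (KP hG R) this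

theorem isField_of_isSimpleRing [Nonempty Λ] (hS : G.NoSources) [IsSimpleRing (KP hG R)] :
    IsField R := by
  have hR : Nontrivial (KP hG R) := inferInstance
  have : Nontrivial R := KP.nontrivial_coeff hG
  refine ⟨exists_pair_ne R, mul_comm, fun {r} hr => ?_⟩
  obtain ⟨a⟩ := ‹Nonempty Λ›
  obtain ⟨x⟩ := PathFamily.nonempty hS a
  let J : TwoSidedIdeal (KP hG R) := TwoSidedIdeal.mk' (Set.range fun z => r • z)
    ⟨0, smul_zero r⟩
    (by rintro _ _ ⟨y, rfl⟩ ⟨z, rfl⟩; exact ⟨y + z, smul_add r y z⟩)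
    (by rintro _ ⟨y, rfl⟩; exact ⟨-y, smul_neg r y⟩)
    (by rintro y _ ⟨z, rfl⟩; exact ⟨y * z, (mul_smul_comm r y z).symm⟩)
    (by rintro _ z ⟨y, rfl⟩; exact ⟨y * z, (smul_mul_assoc r y z).symm⟩)
  have hJ : J = ⊤ := by
    refine (eq_bot_or_eq_top J).resolve_left fun h => ?_
    have : r • KP.p hG R a ∈ J := (TwoSidedIdeal.mem_mk' _ _ _ _ _ _ _).2 ⟨_, rfl⟩
    rw [h, TwoSidedIdeal.mem_bot] at this
    exact rep_infinitePaths_smul_p_ne_zero hG hS hr a this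
  have hp : KP.p hG R a ∈ J := by rw [hJ]; trivial
  obtain ⟨z, hz⟩ := (TwoSidedIdeal.mem_mk' _ _ _ _ _ _ _).1 hp
  -- The diagonal coefficient at `x` of `r • z = p_a` reads `r * (coefficient of z) = 1`.
  have := congrArg (fun z => (PathSpace.infinitePaths G).rep R hG z
    (Finsupp.single ⟨a, x⟩ 1) ⟨a, x⟩) hz
  simp only [PathSpace.rep_smul, LinearMap.smul_apply] at this
  rw [PathSpace.rep_p hG (PathSpace.infinitePaths G) (x := x)] at this
  exact ⟨_, this.trans (Finsupp.single_eq_same)⟩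

/-- The representation on a nonempty path space is faithful if the algebra is simple. -/
theorem eq_zero_of_rep_eq_zero [IsSimpleRing (KP hG R)] (F : G.PathSpace) {a : Λ} (x : F.fiber a)
    {z : KP hG R} (hz : F.rep R hG z = 0) : z = 0 := by
  have hR : Nontrivial (KP hG R) := inferInstance
  have : Nontrivial R := KP.nontrivial_coeff hG
  rcases eq_bot_or_eq_top (TwoSidedIdeal.ker (F.rep R hG)) with h | h
  · have hz' : z ∈ TwoSidedIdeal.ker (F.rep R hG) := (TwoSidedIdeal.mem_ker _).2 hz
    rwa [h, TwoSidedIdeal.mem_bot] at hz'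
  · have hp : KP.p hG R a ∈ TwoSidedIdeal.ker (F.rep R hG) := by rw [h]; trivial
    rw [TwoSidedIdeal.mem_ker] at hp
    have := F.rep_p (R := R) hG x
    rw [hp, LinearMap.zero_apply] at this
    exact absurd this.symm (Finsupp.single_ne_zero.2 one_ne_zero)

theorem cofinal_of_isSimpleRing (hS : G.NoSources) [IsSimpleRing (KP hG R)] : G.Cofinal := by
  have hR : Nontrivial (KP hG R) := inferInstance
  have : Nontrivial R := KP.nontrivial_coeff hG
  intro x a
  by_contra hx
  simp only [not_exists, not_nonempty_iff] at hx
  -- The condition survives removing a prefix because the vertices of `y` are vertices of `fy`. It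
  -- survives adding one because each vertex of `fy` is the range of a path from a vertex of `y`.
  let F := (PathSpace.infinitePaths G).restrict
    (fun b (y : G.PathFamily b) => ∀ n, IsEmpty ((y.path n).1 ⟶ a)) (by
      intro b c f (y : G.PathFamily b)
      constructor
      · intro h n
        have := h (n + G.deg f)
        change IsEmpty ((((y.act f).path (n + G.deg f)).1) ⟶ a) at this
        rwa [PathFamily.act_path_add] at this
      · intro h n
        refine ⟨fun g => ?_⟩
        obtain ⟨e, -⟩ := y.act_isInitial f n
        exact (h n).false (e ≫ g))
  have hz : F.rep R hG (KP.p hG R a) = 0 := by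
    refine PathSpace.end_ext fun y => F.rep_p_of_ne hG ?_
    obtain ⟨b, y, hy⟩ := y
    intro (hb : b = a)
    subst hb
    exact (hy 0).false (PathFamily.path (G := G) y 0).2
  have hp := eq_zero_of_rep_eq_zero hG F
    (⟨PathFamily.ofInfinitePath x, hx⟩ : F.fiber (x.vertex 0)) hz
  refine rep_infinitePaths_smul_p_ne_zero hG hS (one_ne_zero (α := R)) a ?_
  rw [hp, smul_zero]

theorem aperiodic_of_isSimpleRing (hS : G.NoSources) [IsSimpleRing (KP hG R)] : G.Aperiodic := by
  have hR : Nontrivial (KP hG R) := inferInstance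
  have : Nontrivial R := KP.nontrivial_coeff hG
  intro a m n hmn
  by_contra H
  have H' : ∀ (l : CatPath Λ) (_ : l.tgt = a) (h : m ⊔ n ≤ G.deg l.hom),
      G.segment l m (m + (G.deg l.hom - (m ⊔ n))) le_self_add (segment_bound h m le_sup_left) =
      G.segment l n (n + (G.deg l.hom - (m ⊔ n))) le_self_add (segment_bound h n le_sup_right) :=
    fun l hl h => not_not.1 fun hne => H ⟨l, hl, h, hne⟩
  obtain ⟨x⟩ := PathFamily.nonempty hS a
  -- `x = f y = g y`
  obtain ⟨b, f, g, y, hf, hg, hfy, hgy⟩ : ∃ (b : Λ) (f g : b ⟶ a) (y : G.PathFamily b),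
      G.deg f = m ∧ G.deg g = n ∧ y.act f = x ∧ y.act g = x := by
    obtain ⟨y, hy⟩ := x.exists_shift m
    obtain ⟨z, hz⟩ := x.exists_shift n
    have hf := x.deg_path m
    have hg := x.deg_path n
    generalize x.path m = s at *
    generalize x.path n = t at *
    have := shift_eq_shift H' s.2 t.2 hf hg y z (hy.trans hz.symm)
    obtain ⟨c, t⟩ := t
    obtain ⟨b, s⟩ := s
    dsimp only at *
    obtain ⟨rfl, h⟩ := Sigma.mk.inj this
    obtain rfl := eq_of_heq h
    exact ⟨b, s, t, y, hf, hg, hy, hz⟩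
  -- a common initial segment of the translates
  obtain ⟨c, h, z, hh, hz⟩ : ∃ (c : Λ) (h : c ⟶ b) (z : G.PathFamily c),
      G.deg h = (m ⊔ n) ∧ z.act h = y := by
    obtain ⟨z, hz⟩ := y.exists_shift (m ⊔ n)
    exact ⟨_, _, z, y.deg_path _, hz⟩
  -- `(fh)w` agrees with `x` up to degree `(m ⊔ n) + m ≥ n`, so it begins with `g`, say `f(hw) =
  -- gw'`. Equality of shifts gives `w' = hw`.
  have key : ∀ w : G.PathFamily c, w.act (h ≫ f) = w.act (h ≫ g) := by
    intro w
    obtain ⟨w', hw'⟩ := (w.act (h ≫ f)).exists_shift n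
    have h1 : (w.act (h ≫ f)).path n = ⟨b, g⟩ := by
      have h2 : (w.act (h ≫ f)).path (m ⊔ n + m) = x.path (m ⊔ n + m) := by
        rw [← hfy, ← hz, ← PathFamily.act_comp]
        have := PathFamily.act_path_deg (G := G) (h ≫ f) w
        have h3 := PathFamily.act_path_deg (G := G) (h ≫ f) z
        rw [G.deg_comp, hh, hf] at this h3
        rw [this, h3]
      have h4 : n ≤ m ⊔ n + m := le_sup_right.trans le_self_add
      have h5 : (w.act (h ≫ f)).path n = x.path n :=
        IsInitial.unique G (PathFamily.coherent _ n _ h4) (h2 ▸ PathFamily.coherent _ n _ h4)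
          (by rw [PathFamily.deg_path, PathFamily.deg_path])
      rw [h5, ← hgy, ← hg, PathFamily.act_path_deg]
    generalize (w.act (h ≫ f)).path n = t at *
    subst h1
    have h6 := shift_eq_shift H' f g hf hg (w.act h) w' (by rw [← PathFamily.act_comp, hw'])
    simp only [Sigma.mk.injEq, heq_eq_eq, true_and] at h6
    rw [← hw', PathFamily.act_comp, h6]
  have hdeg := (PathSpace.infinitePaths G).deg_eq_of_sub_eq_zero hG z
    (eq_zero_of_rep_eq_zero (R := R) hG (PathSpace.infinitePaths G) z
      ((PathSpace.infinitePaths G).rep_sub_eq_zero hG key))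
  rw [G.deg_comp, G.deg_comp, hf, hg] at hdeg
  exact hmn (add_left_cancel hdeg)

/-! ### Sufficiency: ideals and vertices. -/

/-- An ideal contains all vertices from which one of its vertices can be reached. -/
theorem p_mem_of_hom {I : TwoSidedIdeal (KP hG R)} {a b : Λ} (ha : KP.p hG R a ∈ I) (f : b ⟶ a) :
    KP.p hG R b ∈ I := by
  rw [← KP.sStar_mul_s_self hG f, ← KP.p_mul_s hG f]
  exact I.mul_mem_left _ _ (I.mul_mem_right _ _ ha)

/-- Otherwise (KP4) would write `p_a` as a sum of elements `s_l p_b s_{l*}` of the ideal. -/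
theorem exists_p_not_mem {I : TwoSidedIdeal (KP hG R)} {a : Λ} (ha : KP.p hG R a ∉ I)
    (n : Fin k → ℕ) : ∃ (b : Λ) (f : b ⟶ a), G.deg f = n ∧ KP.p hG R b ∉ I := by
  by_contra! h
  apply ha
  rw [KP.p_eq_sum hG a n]
  refine sum_mem fun l hl => ?_
  rw [Set.Finite.mem_toFinset] at hl
  obtain ⟨b, a, l⟩ := l
  obtain ⟨rfl, hl⟩ := hl
  rw [← KP.s_mul_p hG l]
  exact I.mul_mem_right _ _ (I.mul_mem_left _ _ (h b l hl))

/-- From a vertex outside `I`, paths of degree `(1, …, 1)` can be followed forever through vertices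
outside `I`. Cofinality joins the resulting infinite path `x` to `a`, which puts some `x(n)`, and
with it a later vertex of the sequence, into `I`. -/
theorem Cofinal.p_mem (hC : G.Cofinal) {I : TwoSidedIdeal (KP hG R)} {a : Λ}
    (ha : KP.p hG R a ∈ I) (b : Λ) : KP.p hG R b ∈ I := by
  by_contra hb
  choose c f hf hc using fun b : {b : Λ // KP.p hG R b ∉ I} => exists_p_not_mem hG b.2 1
  let e : ℕ → {b : Λ // KP.p hG R b ∉ I} := fun i => Nat.rec ⟨b, hb⟩ (fun _ d => ⟨c d, hc d⟩) i
  obtain ⟨x, hx⟩ := PathFamily.exists_of_sequence (G := G) (fun i => (e i).1)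
    (fun i => f (e i)) (fun i => (hf _).ge)
  obtain ⟨n, ⟨g⟩⟩ := hC x.toInfinitePath a
  obtain ⟨i, ⟨g'⟩⟩ := hx n
  exact (e i).2 (p_mem_of_hom hG (p_mem_of_hom hG ha g) g')

theorem eq_top_of_p_mem {I : TwoSidedIdeal (KP hG R)} (hI : ∀ a, KP.p hG R a ∈ I) : I = ⊤ := by
  rw [eq_top_iff]
  intro z _
  obtain ⟨n, hn⟩ := KP.exists_mem_level hG z
  rw [KP.level, Finsupp.mem_span_range_iff_exists_finsupp] at hn
  obtain ⟨c, rfl⟩ := hn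
  refine sum_mem fun i _ => ?_
  dsimp only
  rw [← KP.p_mul_s hG i.1.fst, mul_assoc, ← mul_smul_comm]
  exact I.mul_mem_right _ _ (hI _)

theorem isSimpleRing_of_aperiodic_of_cofinal [Nonempty Λ] (hS : G.NoSources) (hR : IsField R)
    (hA : G.Aperiodic) (hC : G.Cofinal) : IsSimpleRing (KP hG R) := by
  have : Nontrivial R := hR.nontrivial
  have : Nontrivial (KP hG R) := by
    obtain ⟨a⟩ := ‹Nonempty Λ›
    exact ⟨_, 0, rep_infinitePaths_smul_p_ne_zero hG hS (one_ne_zero (α := R)) a⟩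
  refine ⟨⟨fun I => or_iff_not_imp_left.2 fun hI => ?_⟩⟩
  obtain ⟨z, hz, hz0⟩ : ∃ z ∈ I, z ≠ 0 := by
    by_contra! h
    exact hI (eq_bot_iff.2 fun z hz => (TwoSidedIdeal.mem_bot _).2 (h z hz))
  obtain ⟨x, y, t, a, ht, e⟩ := KP.exists_mul_mul_eq_smul_p hG hA hz0
  have h1 : t • KP.p hG R a ∈ I := e ▸ I.mul_mem_right _ _ (I.mul_mem_left _ _ hz)
  obtain ⟨t', ht'⟩ := hR.mul_inv_cancel ht
  have h2 : KP.p hG R a ∈ I := by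
    have := I.mul_mem_left (t' • KP.p hG R a) _ h1
    rwa [smul_mul_smul_comm, mul_comm t', ht', one_smul, KP.p_mul_self] at this
  exact eq_top_of_p_mem hG (hC.p_mem hG h2)

end Simplicity

end KGraph

/-- Let `Λ` be a (nonempty) row-finite `k`-graph without sources, `k ≥ 1`, and let `R` be a
commutative ring with `1`.  Then `KP_R(Λ)` is simple if and only if `R` is a field and `Λ` is
aperiodic and cofinal. -/
theorem theorem6p1 {k : ℕ} (hk : 0 < k) {Λ : Type u} [Category.{v} Λ] [Nonempty Λ]
    (G : KGraph k Λ) (hfin : G.RowFinite) (hsrc : G.NoSources) (R : Type w) [CommRing R] :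
    IsSimpleRing (KGraph.KP hfin R) ↔ IsField R ∧ G.Aperiodic ∧ G.Cofinal := by
  constructor
  · intro h
    exact ⟨KGraph.isField_of_isSimpleRing hfin hsrc,
      KGraph.aperiodic_of_isSimpleRing hfin hsrc (R := R),
      KGraph.cofinal_of_isSimpleRing hfin hsrc (R := R)⟩
  · rintro ⟨hR, hA, hC⟩
    exact KGraph.isSimpleRing_of_aperiodic_of_cofinal hfin hsrc hR hA hC
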